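/- A commutative local ring is called uniserial if, as a module over itself, it has a unique composition series; its Loewy length is the least $n$ with $\mathfrak m^n=0$, where $\mathfrak m$ is its maximal ideal. Let $\Lambda$ and $\Gamma$ be commutative local uniserial rings of the same Loewy length $n\le 3$ and with isomorphic residue fields (for example $\mathbb Z/(p^3)$ and $\mathbb F_p[x]/(x^3)$), and let $Q$ be a finite acyclic quiver with vertex set $Q_0$ and arrow set $Q_1$. For $R\in\{\Lambda,\Gamma\}$, let $\operatorname{mono}_Q(R)$ be the full subcategory of the category of representations of $Q$ in finitely generated $R$-modules consisting of those $M=(M_i,M_\alpha)_{i\in Q_0,\alpha\in Q_1}$ for which the map $$\bigoplus_{\alpha\in Q_1,\ t(\alpha)=i} M_{s(\alpha)}\xrightarrow{(M_\alpha)_\alpha} M_i$$ is injective for every vertex $i$, where $s(\alpha)$ and $t(\alpha)$ denote the source and target of $\alpha$. Every finitely generated $R$-module is isomorphic to $R/\mathfrak m^{a_1}\oplus\dots\oplus R/\mathfrak m^{a_s}$ for a unique partition $(a_1\ge\dots\ge a_s)$ with $n\ge a_1$ and $a_s\ge 1$ (empty for the zero module), where $\mathfrak m$ is the maximal ideal of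 $R$; the partition vector of $M$ is the tuple of the partitions of the modules $M_i$, $i\in Q_0$. Then there is a bijection between the isomorphism classes of indecomposable objects of $\operatorname{mono}_Q(\Lambda)$ and those of $\operatorname{mono}_Q(\Gamma)$ that preserves partition vectors. -/

import Mathlib

universe u v w w'

/-- A ring is uniserial if, as a module over itself, it has a unique composition series
`⊥ = I₀ ⋖ I₁ ⋖ ⋯ ⋖ Iₗ = ⊤`. -/
def IsUniserialRing (R : Type u) [CommRing R] : Prop :=
  ∃! s : CompositionSeries (Submodule R R), s.head = ⊥ ∧ s.last = ⊤

/-- The Loewy length of an artinian ring: the least `n` such that the `n`-th power of the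
(nilpotent) Jacobson radical vanishes. -/
noncomputable def loewyLength (R : Type u) [CommRing R] : ℕ :=
  sInf {n : ℕ | Ring.jacobson R ^ n = ⊥}

/-- The list `α = (α₁ ≥ α₂ ≥ ⋯ ≥ αₛ)`, with `1 ≤ αₖ ≤ loewyLength R`, is the partition of the
`R`-module `M`: `M ≅ R/𝔪^α₁ ⊕ ⋯ ⊕ R/𝔪^αₛ`, with `𝔪` the maximal ideal of `R`. -/
def HasPartition (R : Type u) [CommRing R] [IsLocalRing R]
    (M : Type v) [AddCommGroup M] [Module R M] (α : List ℕ) : Prop :=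
  α.Pairwise (· ≥ ·) ∧ (∀ a ∈ α, 1 ≤ a ∧ a ≤ loewyLength R) ∧
    Nonempty (M ≃ₗ[R] ∀ k : Fin α.length, R ⧸ IsLocalRing.maximalIdeal R ^ α.get k)

/-- A quiver is acyclic if every oriented path from a vertex to itself is trivial. -/
def Quiver.IsAcyclic (Q : Type w) [Quiver.{w'} Q] : Prop :=
  ∀ (i : Q) (p : Quiver.Path i i), p.length = 0

/-- Representations of a quiver `Q` in finitely generated `R`-modules. The modules are taken in the
universe of `R`, where every finitely generated `R`-module has an isomorphic copy. -/
structure QuiverRep (Q : Type w) [Quiver.{w'} Q] (R : Type u) [CommRing R] where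
  obj : Q → Type u
  [addCommGroup : ∀ i, AddCommGroup (obj i)]
  [module : ∀ i, Module R (obj i)]
  [finite : ∀ i, Module.Finite R (obj i)]
  map : ∀ {i j : Q}, (i ⟶ j) → obj i →ₗ[R] obj j

namespace QuiverRep

attribute [instance] QuiverRep.addCommGroup QuiverRep.module QuiverRep.finite

section

variable {Q : Type w} [Quiver.{w'} Q] {R : Type u} [CommRing R]

/-- Isomorphisms of representations. -/
structure Iso (M N : QuiverRep Q R) where
  equiv : ∀ i, M.obj i ≃ₗ[R] N.obj i
  comm : ∀ {i j : Q} (a : i ⟶ j) (x : M.obj i), equiv j (M.map a x) = N.map a (equiv i x)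

/-- The direct sum of two representations. -/
def directSum (M N : QuiverRep Q R) : QuiverRep Q R where
  obj i := M.obj i × N.obj i
  map a := (M.map a).prodMap (N.map a)

/-- The zero representations. -/
def IsZero (M : QuiverRep Q R) : Prop :=
  ∀ i, Subsingleton (M.obj i)

variable [Fintype Q] [∀ i j : Q, Fintype (i ⟶ j)]

/-- The map `⨁_{a : j ⟶ i} M j ⟶ M i`, over all arrows `a` with target `i`, with components
`M.map a`. -/
def inMap (M : QuiverRep Q R) (i : Q) :
    (∀ a : (Σ j : Q, (j ⟶ i)), M.obj a.1) →ₗ[R] M.obj i :=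
  ∑ a : (Σ j : Q, (j ⟶ i)), (M.map a.2).comp (LinearMap.proj a)

/-- Membership in the (separated) monomorphism category. -/
def IsMono (M : QuiverRep Q R) : Prop :=
  ∀ i, Function.Injective (M.inMap i)

/-- Indecomposable objects of the monomorphism category. -/
def IsIndecomposableMono (M : QuiverRep Q R) : Prop :=
  M.IsMono ∧ ¬ M.IsZero ∧
    ∀ A B : QuiverRep Q R, A.IsMono → B.IsMono → Nonempty (M.Iso (A.directSum B)) →
      A.IsZero ∨ B.IsZero

end

variable (Q : Type w) [Quiver.{w'} Q] [Fintype Q] [∀ i j : Q, Fintype (i ⟶ j)]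
  (R : Type u) [CommRing R]

/-- Isomorphism as an equivalence relation on the indecomposable objects of the monomorphism
category. -/
def indecMonoSetoid : Setoid {M : QuiverRep Q R // M.IsIndecomposableMono} where
  r M N := Nonempty (M.1.Iso N.1)
  iseqv :=
    { refl := fun _ => ⟨⟨fun _ => LinearEquiv.refl R _, fun _ _ => rfl⟩⟩
      symm := fun ⟨e⟩ => ⟨⟨fun i => (e.equiv i).symm, fun a x => by
        rw [LinearEquiv.symm_apply_eq, e.comm, LinearEquiv.apply_symm_apply]⟩⟩
      trans := fun ⟨e⟩ ⟨f⟩ => ⟨⟨fun i => (e.equiv i).trans (f.equiv i), fun a x => by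
        simp only [LinearEquiv.trans_apply, e.comm, f.comm]⟩⟩ }

/-- Isomorphism classes of indecomposable objects of the monomorphism category. -/
def IndecMono : Type _ :=
  Quotient (indecMonoSetoid Q R)

variable {Q R}

/-- `α = (αⁱ)ᵢ` is the partition vector of the isomorphism class `x`: for a representation `M` in
the class, `αⁱ` is the partition of `M i` for every vertex `i`. -/
def IndecMono.HasPartitionVector [IsLocalRing R] (x : IndecMono Q R) (α : Q → List ℕ) : Prop :=
  ∃ M : {M : QuiverRep Q R // M.IsIndecomposableMono},
    Quotient.mk (indecMonoSetoid Q R) M = x ∧ ∀ i, HasPartition R (M.1.obj i) (α i)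

end QuiverRep

/-!
Let `ϖ` generate the maximal ideal of `R`, of Loewy length `n`, and let `k` be its residue field.
The maps `R ⧸ ϖ ^ a → M` modulo those that factor through free modules form the subquotient
`M[ϖ ^ a] ⧸ ϖ ^ (n - a) M`. For `n ≤ 3` it is killed by `ϖ`: this has to be checked for
`M = R ⧸ ϖ ^ c` only, where it has length `min a c - (c - (n - a)) ≤ 1` if `0 < a, c < n`. So these
subquotients, with the maps between them induced by `ϖ` and by inclusions, are vector spaces over
`k`, and the stable category of finitely generated `R`-modules depends on `k` and `n` only.

A representation `M` in the monomorphism category thus gives a representation of the quiver by such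
systems of vector spaces. Together with the spaces `ϖ ^ (n - 1) • coker (M.inMap i)`, which count
the free summands of the cokernels, it determines `M` up to isomorphism. Indeed, a stable map can
be lifted to a linear map and, `R` being self-injective, the lift can be corrected by stably zero
maps so that it restricts to a given map on the submodule `⨁ M j` of `M i`. By acyclicity, this
constructs the isomorphism one vertex at a time. In the same way every such datum built from stable
systems of modules comes from a monomorphic representation: adding to the target of a map the
injective hull of its kernel, which is free, makes it injective without a stable change, and a
further free summand adjusts the cokernel.

The partition of `M i` is determined by the lengths of `M i[ϖ] ∩ ϖ ^ (b - 1) M i`. Modulo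
`M i[ϖ] ∩ ϖ ^ (n - 1) M i` these submodules are visible in the stable system, and the length of the
latter is obtained from the data at `i` and the lengths of the `M j[ϖ]`, by induction along the
quiver.
-/

universe u'

section SemilinearMaps

variable {R S T : Type*} [CommRing R] [CommRing S] [CommRing T]
  {σ : R →+* S} {τ : S →+* T} {ρ : R →+* T} [RingHomCompTriple σ τ ρ] [RingHomSurjective σ]
  {U A B : Type*} [AddCommGroup U] [Module R U] [AddCommGroup A] [Module S A]
  [AddCommGroup B] [Module T B]

theorem exists_comp_eq_of_ker_le {f : U →ₛₗ[σ] A}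
    (hf : Function.Surjective f) {g : U →ₛₗ[ρ] B} (h : ∀ x, f x = 0 → g x = 0) :
    ∃ l : A →ₛₗ[τ] B, ∀ x, l (f x) = g x := by
  have well_defined : ∀ x x', f x = f x' → g x = g x' := fun x x' hx => by
    rw [← sub_eq_zero, ← map_sub] at hx ⊢
    exact h _ hx
  choose s hs using hf
  have key : ∀ x, g (s (f x)) = g x := fun x => well_defined _ _ (hs _)
  refine ⟨⟨⟨fun y => g (s y), fun y z => ?_⟩, fun c y => ?_⟩, key⟩
  · rw [← map_add]
    exact well_defined _ _ (by simp only [hs, map_add])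
  · obtain ⟨r, rfl⟩ := σ.surjective c
    change _ = τ (σ r) • g (s y)
    rw [← RingHom.comp_apply, RingHomCompTriple.comp_eq, ← map_smulₛₗ]
    exact well_defined _ _ (by simp only [hs, map_smulₛₗ])

theorem exists_linearEquiv_of_ker_eq {C : Type*} [AddCommGroup C] [Module S C]
    {f : U →ₛₗ[σ] A} {g : U →ₛₗ[σ] C} (hf : Function.Surjective f)
    (hg : Function.Surjective g) (h : ∀ x, f x = 0 ↔ g x = 0) :
    ∃ e : A ≃ₗ[S] C, ∀ x, e (f x) = g x := by
  obtain ⟨l, hl⟩ := exists_comp_eq_of_ker_le (τ := RingHom.id S) hf fun x => (h x).1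
  obtain ⟨l', hl'⟩ := exists_comp_eq_of_ker_le (τ := RingHom.id S) hg fun x => (h x).2
  refine ⟨LinearEquiv.ofLinearMap l l' ?_ ?_, hl⟩
  · refine LinearMap.ext (hg.forall.2 fun x => ?_)
    rw [LinearMap.comp_apply, hl', hl, LinearMap.id_apply]
  · refine LinearMap.ext (hf.forall.2 fun x => ?_)
    rw [LinearMap.comp_apply, hl, hl', LinearMap.id_apply]

theorem length_quotient_ker_eq_length_range (f : U →ₛₗ[σ] A) :
    Module.length R (U ⧸ LinearMap.ker f) = Module.length S (LinearMap.range f) := by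
  obtain ⟨l, hl⟩ := exists_comp_eq_of_ker_le (σ := RingHom.id R) (τ := σ)
    (Submodule.mkQ_surjective (LinearMap.ker f)) (g := f.rangeRestrict)
    (fun x hx => Subtype.ext (by simpa using hx))
  have injective : Function.Injective l := by
    rw [injective_iff_map_eq_zero, (Submodule.mkQ_surjective _).forall]
    intro x hx
    rw [hl] at hx
    simpa using congrArg Subtype.val hx
  have surjective : Function.Surjective l := fun y => by
    obtain ⟨x, rfl⟩ := f.surjective_rangeRestrict y
    exact ⟨_, hl x⟩
  rw [← WithBot.coe_inj, Module.coe_length, Module.coe_length]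
  exact Order.krullDim_eq_of_orderIso
    (Submodule.orderIsoMapComapOfBijective l ⟨injective, surjective⟩)

theorem length_range_eq_of_ker_eq {S' : Type*} [CommRing S'] {σ' : R →+* S'} [RingHomSurjective σ']
    {C : Type*} [AddCommGroup C] [Module S' C] {f : U →ₛₗ[σ] A} {g : U →ₛₗ[σ'] C}
    (h : LinearMap.ker f = LinearMap.ker g) :
    Module.length S (LinearMap.range f) = Module.length S' (LinearMap.range g) := by
  rw [← length_quotient_ker_eq_length_range, h, length_quotient_ker_eq_length_range]

theorem length_eq_length_ker_add_length_range (f : U →ₛₗ[σ] A) :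
    Module.length R U =
      Module.length R (LinearMap.ker f) + Module.length S (LinearMap.range f) := by
  rw [← length_quotient_ker_eq_length_range]
  exact Module.length_eq_add_of_exact _ _ (Submodule.injective_subtype _)
    (Submodule.mkQ_surjective _) (LinearMap.exact_subtype_mkQ _)

theorem length_eq_length_inf_ker_add_length_map (f : U →ₛₗ[σ] A) (p : Submodule R U) :
    Module.length R p =
      Module.length R (p ⊓ LinearMap.ker f : Submodule R U) + Module.length S (p.map f) := by
  rw [length_eq_length_ker_add_length_range (f.domRestrict p), LinearMap.range_domRestrict,
    LinearMap.ker_domRestrict, ← Submodule.map_comap_subtype]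
  exact congrArg (· + _) (Submodule.equivMapOfInjective _ p.injective_subtype _).length_eq

end SemilinearMaps

namespace IsUniserialRing

variable {R : Type u} [CommRing R]

theorem isNoetherianRing (h : IsUniserialRing R) : IsNoetherianRing R :=
  (isFiniteLength_iff_isNoetherian_isArtinian.mp
    (isFiniteLength_iff_exists_compositionSeries.mpr h.exists)).1

theorem isArtinianRing (h : IsUniserialRing R) : IsArtinianRing R :=
  (isFiniteLength_iff_isNoetherian_isArtinian.mp
    (isFiniteLength_iff_exists_compositionSeries.mpr h.exists)).2

theorem le_total (h : IsUniserialRing R) (I J : Ideal R) : I ≤ J ∨ J ≤ I := by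
  have := h.isNoetherianRing
  have := h.isArtinianRing
  have exists_series (K : Submodule R R) : ∃ s : CompositionSeries (Submodule R R),
      (s.head = ⊥ ∧ s.last = ⊤) ∧ K ∈ s := by
    obtain ⟨s, i, hi, hs⟩ :=
      LTSeries.exists_relSeries_covBy_and_head_eq_bot_and_last_eq_bot (RelSeries.singleton _ K)
    exact ⟨s, hs, i 0, congrFun hi 0⟩
  obtain ⟨s, hs, hI⟩ := exists_series I
  obtain ⟨t, ht, hJ⟩ := exists_series J
  obtain rfl := h.unique hs ht
  exact CompositionSeries.total hI hJ

theorem exists_eq_span_singleton (h : IsUniserialRing R) (I : Ideal R) :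
    ∃ x, I = Ideal.span {x} := by
  have := h.isNoetherianRing
  refine Submodule.fg_induction (motive := fun I _ => ∃ x, I = Ideal.span {x})
    (fun x => ⟨x, rfl⟩) ?_ I (IsNoetherian.noetherian I)
  rintro I J - - ⟨x, hx⟩ ⟨y, hy⟩
  rcases h.le_total I J with hle | hle
  · exact ⟨y, by rw [sup_eq_right.mpr hle, hy]⟩
  · exact ⟨x, by rw [sup_eq_left.mpr hle, hx]⟩

end IsUniserialRing

/-- `ϖ` generates the maximal ideal of the local ring `R`, and `n` is its nilpotency index. Such an
`R` has `⊥ = (ϖ ^ n) < ⋯ < (ϖ) < ⊤` as its only ideals. -/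
structure IsUniformizer {R : Type*} [CommRing R] [IsLocalRing R] (ϖ : R) (n : ℕ) : Prop where
  maximalIdeal_eq : IsLocalRing.maximalIdeal R = Ideal.span {ϖ}
  pow_eq_zero_iff : ∀ a, ϖ ^ a = 0 ↔ n ≤ a

theorem loewyLength_le_iff {R : Type*} [CommRing R] [IsArtinianRing R] (a : ℕ) :
    loewyLength R ≤ a ↔ Ring.jacobson R ^ a = ⊥ := by
  have hne : {m : ℕ | Ring.jacobson R ^ m = ⊥}.Nonempty := by
    obtain ⟨m, hm⟩ := IsArtinianRing.isNilpotent_jacobson_bot (R := R)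
    exact ⟨m, by simpa [Ideal.jacobson_bot] using hm⟩
  refine ⟨fun h => ?_, fun h => Nat.sInf_le h⟩
  exact le_bot_iff.1 ((Ideal.pow_le_pow_right h).trans (Nat.sInf_mem hne).le)

theorem IsUniserialRing.exists_isUniformizer {R : Type*} [CommRing R] [IsLocalRing R]
    (h : IsUniserialRing R) : ∃ ϖ : R, IsUniformizer ϖ (loewyLength R) := by
  have := h.isArtinianRing
  obtain ⟨ϖ, hϖ⟩ := h.exists_eq_span_singleton (IsLocalRing.maximalIdeal R)
  refine ⟨ϖ, hϖ, fun a => ?_⟩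
  rw [loewyLength_le_iff, IsLocalRing.ringJacobson_eq_maximalIdeal, hϖ,
    Ideal.span_singleton_pow, Ideal.span_singleton_eq_bot]

namespace IsUniformizer

variable {R : Type u} [CommRing R] [IsLocalRing R] {ϖ : R} {n : ℕ} (hϖ : IsUniformizer ϖ n)

include hϖ

theorem pos : 0 < n := by
  by_contra hn
  exact one_ne_zero ((pow_zero ϖ).symm.trans ((hϖ.pow_eq_zero_iff 0).2 (not_lt.1 hn)))

theorem pow_self : ϖ ^ n = 0 := (hϖ.pow_eq_zero_iff n).2 le_rfl

theorem mem_maximalIdeal_pow {a : ℕ} {r : R} :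
    r ∈ IsLocalRing.maximalIdeal R ^ a ↔ ϖ ^ a ∣ r := by
  rw [hϖ.maximalIdeal_eq, Ideal.span_singleton_pow, Ideal.mem_span_singleton]

theorem not_isUnit_iff {r : R} : ¬ IsUnit r ↔ ϖ ∣ r := by
  rw [← Ideal.mem_span_singleton, ← hϖ.maximalIdeal_eq, IsLocalRing.mem_maximalIdeal,
    mem_nonunits_iff]

theorem map_eq_zero_iff {k : Type*} [Field k] {ρ : R →+* k} (hρ : Function.Surjective ρ) {r : R} :
    ρ r = 0 ↔ ϖ ∣ r := by
  rw [← RingHom.mem_ker, IsLocalRing.eq_maximalIdeal (RingHom.ker_isMaximal_of_surjective ρ hρ),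
    hϖ.maximalIdeal_eq, Ideal.mem_span_singleton]

theorem exists_isUnit_mul_pow (r : R) : ∃ a ≤ n, ∃ s, IsUnit s ∧ r = s * ϖ ^ a := by
  have main : ∀ m ≤ n, ϖ ^ m ∣ r ∨ ∃ a < m, ∃ s, IsUnit s ∧ r = s * ϖ ^ a := by
    intro m
    induction m with
    | zero => simp
    | succ m ih =>
      intro hm
      rcases ih (by omega) with ⟨s, hs⟩ | ⟨a, ha, h⟩
      · by_cases hu : IsUnit s
        · exact Or.inr ⟨m, by omega, s, hu, hs.trans (mul_comm _ _)⟩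
        · exact Or.inl (by rw [hs, pow_succ]; exact mul_dvd_mul_left _ (hϖ.not_isUnit_iff.1 hu))
      · exact Or.inr ⟨a, by omega, h⟩
  rcases main n le_rfl with h | ⟨a, ha, h⟩
  · rw [hϖ.pow_self, zero_dvd_iff] at h
    exact ⟨n, le_rfl, 1, isUnit_one, by rw [h, hϖ.pow_self, mul_zero]⟩
  · exact ⟨a, ha.le, h⟩

theorem pow_dvd_pow_iff {a b : ℕ} (ha : a ≤ n) : ϖ ^ a ∣ ϖ ^ b ↔ a ≤ b := by
  refine ⟨fun h => ?_, pow_dvd_pow ϖ⟩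
  have h0 := mul_dvd_mul_left (ϖ ^ (n - a)) h
  rw [← pow_add, ← pow_add, Nat.sub_add_cancel ha, hϖ.pow_self, zero_dvd_iff,
    hϖ.pow_eq_zero_iff] at h0
  omega

theorem pow_dvd_pow_mul_iff {a b : ℕ} (ha : a ≤ n) {r : R} :
    ϖ ^ a ∣ ϖ ^ b * r ↔ ϖ ^ (a - b) ∣ r := by
  obtain ⟨c, -, s, hs, rfl⟩ := hϖ.exists_isUnit_mul_pow r
  rw [mul_left_comm, ← pow_add, hs.dvd_mul_left, hs.dvd_mul_left, hϖ.pow_dvd_pow_iff ha,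
    hϖ.pow_dvd_pow_iff (by omega), tsub_le_iff_left]

theorem pow_mul_eq_zero_iff {b : ℕ} {r : R} : ϖ ^ b * r = 0 ↔ ϖ ^ (n - b) ∣ r := by
  rw [← zero_dvd_iff, ← hϖ.pow_self, hϖ.pow_dvd_pow_mul_iff le_rfl]

theorem exists_ideal_eq_span_pow (I : Ideal R) : ∃ a ≤ n, I = Ideal.span {ϖ ^ a} := by
  classical
  have hex : ∃ a, ϖ ^ a ∈ I := ⟨n, by rw [hϖ.pow_self]; exact I.zero_mem⟩
  refine ⟨Nat.find hex, Nat.find_min' hex (by rw [hϖ.pow_self]; exact I.zero_mem),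
    le_antisymm (fun x hx => ?_) ((Ideal.span_singleton_le_iff_mem I).2 (Nat.find_spec hex))⟩
  obtain ⟨b, -, s, hs, rfl⟩ := hϖ.exists_isUnit_mul_pow x
  rw [Ideal.unit_mul_mem_iff_mem I hs] at hx
  exact Ideal.mem_span_singleton.2 (Dvd.dvd.mul_left (pow_dvd_pow ϖ (Nat.find_min' hex hx)) s)

theorem isNoetherianRing : IsNoetherianRing R := by
  have : IsPrincipalIdealRing R := ⟨fun I => by
    obtain ⟨a, -, ha⟩ := hϖ.exists_ideal_eq_span_pow I
    exact ⟨_, ha⟩⟩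
  infer_instance

theorem isArtinianRing : IsArtinianRing R := by
  have := hϖ.isNoetherianRing
  refine (isArtinianRing_iff_isNilpotent_maximalIdeal R).2 ⟨n, ?_⟩
  rw [hϖ.maximalIdeal_eq, Ideal.span_singleton_pow, hϖ.pow_self, Ideal.span_singleton_eq_bot.2 rfl,
    Ideal.zero_eq_bot]

theorem loewyLength_eq : loewyLength R = n := by
  have := hϖ.isArtinianRing
  refine eq_of_forall_ge_iff fun a => ?_
  rw [loewyLength_le_iff, IsLocalRing.ringJacobson_eq_maximalIdeal, hϖ.maximalIdeal_eq,
    Ideal.span_singleton_pow, Ideal.span_singleton_eq_bot, hϖ.pow_eq_zero_iff]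

theorem baer : Module.Baer R R := by
  intro I g
  obtain ⟨a, ha, rfl⟩ := hϖ.exists_ideal_eq_span_pow I
  let x : Ideal.span {ϖ ^ a} := ⟨ϖ ^ a, Ideal.mem_span_singleton_self _⟩
  obtain ⟨c, hc⟩ : ϖ ^ a ∣ g x := by
    have h0 : ϖ ^ (n - a) • x = 0 := Subtype.ext <| by
      change ϖ ^ (n - a) * ϖ ^ a = 0
      rw [← pow_add, Nat.sub_add_cancel ha, hϖ.pow_self]
    have h := hϖ.pow_mul_eq_zero_iff.1 ((map_smul g _ x).symm.trans (by rw [h0, map_zero]))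
    rwa [Nat.sub_sub_self ha] at h
  refine ⟨LinearMap.lsmul R R c, fun y hy => ?_⟩
  obtain ⟨t, rfl⟩ := Ideal.mem_span_singleton.1 hy
  have hy' : (⟨ϖ ^ a * t, hy⟩ : Ideal.span {ϖ ^ a}) = t • x := Subtype.ext (mul_comm _ _)
  rw [hy', map_smul, hc, LinearMap.lsmul_apply, smul_eq_mul, smul_eq_mul]
  ring

theorem exists_extension {M N ι : Type*} [AddCommGroup M] [Module R M] [AddCommGroup N]
    [Module R N] {f : M →ₗ[R] N} {g : M →ₗ[R] (ι → R)} (h : ∀ x, f x = 0 → g x = 0) :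
    ∃ h : N →ₗ[R] (ι → R), ∀ x, h (f x) = g x := by
  obtain ⟨l, hl⟩ := exists_comp_eq_of_ker_le (τ := RingHom.id R)
    f.surjective_rangeRestrict (g := g) fun x hx => h x (congrArg Subtype.val hx)
  choose l' hl' using fun j => hϖ.baer.extension_property _
    (LinearMap.range f).injective_subtype ((LinearMap.proj j).comp l)
  refine ⟨LinearMap.pi l', fun x => ?_⟩
  rw [← hl]
  exact funext fun j => LinearMap.congr_fun (hl' j) (f.rangeRestrict x)

end IsUniformizer

section PowTorsion

variable {R M N : Type*} [CommRing R] [AddCommGroup M] [Module R M] [AddCommGroup N] [Module R N]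

/-- The submodule `M[ϖ ^ a]` of the elements of `M` killed by `ϖ ^ a`, that is,
`Hom(R ⧸ ϖ ^ a, M)`. -/
abbrev powTorsion (ϖ : R) (M : Type*) [AddCommGroup M] [Module R M] (a : ℕ) : Submodule R M :=
  Submodule.torsionBy R M (ϖ ^ a)

/-- The map `M[ϖ ^ a] → M[ϖ ^ b]` given by multiplication with `ϖ ^ (a - b)`; by truncation it is
the inclusion for `a ≤ b`. -/
def powTorsionTransition (ϖ : R) (M : Type*) [AddCommGroup M] [Module R M] (a b : ℕ) :
    powTorsion ϖ M a →ₗ[R] powTorsion ϖ M b :=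
  (LinearMap.lsmul R M (ϖ ^ (a - b))).restrict fun x hx => by
    rw [Submodule.mem_torsionBy_iff] at hx ⊢
    rw [LinearMap.lsmul_apply, smul_smul, ← pow_add,
      show b + (a - b) = b - a + a by omega, pow_add, mul_smul, hx, smul_zero]

/-- The restriction `M[ϖ ^ a] → N[ϖ ^ a]` of a linear map. -/
def powTorsionMap (ϖ : R) (h : M →ₗ[R] N) (a : ℕ) : powTorsion ϖ M a →ₗ[R] powTorsion ϖ N a :=
  h.restrict fun x hx => by
    rw [Submodule.mem_torsionBy_iff] at hx ⊢
    rw [← map_smul, hx, map_zero]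

@[simp]
theorem coe_powTorsionTransition {ϖ : R} {a b : ℕ} (x : powTorsion ϖ M a) :
    (powTorsionTransition ϖ M a b x : M) = ϖ ^ (a - b) • (x : M) :=
  rfl

@[simp]
theorem coe_powTorsionMap {ϖ : R} {a : ℕ} (h : M →ₗ[R] N) (x : powTorsion ϖ M a) :
    (powTorsionMap ϖ h a x : N) = h x :=
  rfl

theorem powTorsionMap_transition {ϖ : R} {a b : ℕ} (h : M →ₗ[R] N) (x : powTorsion ϖ M a) :
    powTorsionMap ϖ h b (powTorsionTransition ϖ M a b x) =
      powTorsionTransition ϖ N a b (powTorsionMap ϖ h a x) :=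
  Subtype.ext (map_smul h _ _)

end PowTorsion

/-- `M` is the direct sum of the cyclic submodules generated by the `e j`, and the annihilator of
`e j` is `(ϖ ^ a j)`. -/
structure IsCyclicBasis {R M ι : Type*} [CommRing R] [AddCommGroup M] [Module R M] [Fintype ι]
    (ϖ : R) (e : ι → M) (a : ι → ℕ) : Prop where
  surjective : Function.Surjective (Fintype.linearCombination R e)
  eq_zero_iff : ∀ r, Fintype.linearCombination R e r = 0 ↔ ∀ j, ϖ ^ a j ∣ r j

namespace IsCyclicBasis

variable {R M N ι : Type*} [CommRing R] [AddCommGroup M] [Module R M] [AddCommGroup N]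
  [Module R N] [Fintype ι] {ϖ : R} {e : ι → M} {a : ι → ℕ} (he : IsCyclicBasis ϖ e a)

include he

theorem map (f : M ≃ₗ[R] N) : IsCyclicBasis ϖ (fun j => f (e j)) a := by
  have key : Fintype.linearCombination R (fun j => f (e j)) =
      (f : M →ₗ[R] N) ∘ₗ Fintype.linearCombination R e := by
    ext r
    simp [Fintype.linearCombination_apply]
  refine ⟨?_, fun r => ?_⟩
  · rw [key]
    exact f.surjective.comp he.surjective
  · rw [key, LinearMap.comp_apply, LinearEquiv.coe_coe, map_eq_zero_iff f f.injective,
      he.eq_zero_iff]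

theorem pow_smul (j : ι) : ϖ ^ a j • e j = 0 := by
  classical
  rw [← Fintype.linearCombination_apply_single, he.eq_zero_iff]
  intro i
  obtain rfl | hij := eq_or_ne i j
  · simp
  · simp [hij]

theorem exists_linearMap (y : ι → N) (hy : ∀ j, ϖ ^ a j • y j = 0) :
    ∃ h : M →ₗ[R] N, ∀ j, h (e j) = y j := by
  classical
  obtain ⟨h, hh⟩ := exists_comp_eq_of_ker_le (τ := RingHom.id R) he.surjective
    (g := Fintype.linearCombination R y) fun r hr => Finset.sum_eq_zero fun j _ => by
      obtain ⟨t, ht⟩ := (he.eq_zero_iff r).1 hr j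
      rw [ht, mul_comm, mul_smul, hy, smul_zero]
  exact ⟨h, fun j => by simpa using hh (Pi.single j 1)⟩

theorem linearMap_ext {S A : Type*} [CommRing S] {σ : R →+* S} [AddCommGroup A] [Module S A]
    {f g : M →ₛₗ[σ] A} (h : ∀ j, f (e j) = g (e j)) : f = g := by
  refine LinearMap.ext (he.surjective.forall.2 fun r => ?_)
  simp only [Fintype.linearCombination_apply, map_sum, map_smulₛₗ, h]

theorem exists_pow_smul_eq_iff {m : ℕ} {r : ι → R} :
    (∃ z, ϖ ^ m • z = Fintype.linearCombination R e r) ↔ ∀ j, ϖ ^ min (a j) m ∣ r j := by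
  constructor
  · rintro ⟨z, hz⟩ j
    obtain ⟨s, rfl⟩ := he.surjective z
    rw [← map_smul, eq_comm, ← sub_eq_zero, ← map_sub, he.eq_zero_iff] at hz
    have h := (pow_dvd_pow ϖ (min_le_left (a j) m)).trans (hz j)
    exact (dvd_sub_left (Dvd.dvd.mul_right (pow_dvd_pow ϖ (min_le_right _ _)) _)).1 h
  · intro h
    choose s hs using h
    refine ⟨Fintype.linearCombination R e fun j => if m ≤ a j then s j else 0, ?_⟩
    rw [← map_smul, eq_comm, ← sub_eq_zero, ← map_sub, he.eq_zero_iff]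
    intro j
    rw [Pi.sub_apply, Pi.smul_apply, hs j]
    split_ifs with hj
    · simp [min_eq_right hj]
    · simp [min_eq_left (not_le.1 hj).le]

theorem pow_smul_eq_zero_iff [IsLocalRing R] {n : ℕ} (hϖ : IsUniformizer ϖ n) (ha : ∀ j, a j ≤ n)
    {t : ℕ} {r : ι → R} :
    ϖ ^ t • Fintype.linearCombination R e r = 0 ↔ ∀ j, ϖ ^ (a j - t) ∣ r j := by
  rw [← map_smul, he.eq_zero_iff]
  exact forall_congr' fun j => hϖ.pow_dvd_pow_mul_iff (ha j)

end IsCyclicBasis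

theorem IsUniformizer.isCyclicBasis_single {R ι : Type*} [CommRing R] [IsLocalRing R] {ϖ : R}
    {n : ℕ} (hϖ : IsUniformizer ϖ n) [Fintype ι] [DecidableEq ι] (a : ι → ℕ) :
    IsCyclicBasis ϖ (M := ∀ j, R ⧸ IsLocalRing.maximalIdeal R ^ a j)
      (fun j => Pi.single j 1) a := by
  have key (r : ι → R) : Fintype.linearCombination R
      (M := ∀ j, R ⧸ IsLocalRing.maximalIdeal R ^ a j) (fun j => Pi.single j 1) r =
        fun j => Ideal.Quotient.mk _ (r j) := by
    rw [Fintype.linearCombination_apply, ← Finset.univ_sum_single (fun j => Ideal.Quotient.mk _ _)]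
    refine Finset.sum_congr rfl fun j _ => ?_
    rw [← Pi.single_smul, Algebra.smul_def, mul_one]
    rfl
  refine ⟨fun x => ?_, fun r => ?_⟩
  · choose r hr using fun j => Ideal.Quotient.mk_surjective (x j)
    exact ⟨r, (key r).trans (funext hr)⟩
  · rw [key, funext_iff]
    exact forall_congr' fun j => Ideal.Quotient.eq_zero_iff_mem.trans hϖ.mem_maximalIdeal_pow

namespace HasPartition

variable {R : Type*} [CommRing R] [IsLocalRing R] {M N : Type*} [AddCommGroup M]
  [Module R M] [AddCommGroup N] [Module R N] {α : List ℕ}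

theorem of_linearEquiv (h : HasPartition R M α) (e : M ≃ₗ[R] N) : HasPartition R N α :=
  ⟨h.1, h.2.1, h.2.2.map e.symm.trans⟩

theorem of_subsingleton [Subsingleton M] : HasPartition R M [] :=
  ⟨.nil, by simp, ⟨⟨0, 0, fun _ => Subsingleton.elim _ _, fun _ => funext fun j => j.elim0⟩⟩⟩

theorem subsingleton (h : HasPartition R M []) : Subsingleton M := by
  obtain ⟨-, -, ⟨e⟩⟩ := h
  exact e.toEquiv.subsingleton_congr.2 ⟨fun _ _ => funext fun j => j.elim0⟩

theorem cons (h : HasPartition R N α) {a : ℕ} (hα : ∀ c ∈ α, c ≤ a) (ha : 1 ≤ a)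
    (han : a ≤ loewyLength R) (e : ((R ⧸ IsLocalRing.maximalIdeal R ^ a) × N) ≃ₗ[R] M) :
    HasPartition R M (a :: α) := by
  obtain ⟨sorted, bounds, ⟨f⟩⟩ := h
  exact ⟨List.pairwise_cons.2 ⟨hα, sorted⟩, List.forall_mem_cons.2 ⟨⟨ha, han⟩, bounds⟩,
    ⟨e.symm.trans (((LinearEquiv.refl R _).prodCongr f).trans
      (Fin.consLinearEquiv R fun i : Fin (α.length + 1) =>
        R ⧸ IsLocalRing.maximalIdeal R ^ (a :: α).get i))⟩⟩

theorem exists_isCyclicBasis {ϖ : R} {n : ℕ} (hϖ : IsUniformizer ϖ n) (h : HasPartition R M α) :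
    ∃ e : Fin α.length → M, IsCyclicBasis ϖ e α.get := by
  obtain ⟨-, -, ⟨f⟩⟩ := h
  exact ⟨_, (hϖ.isCyclicBasis_single α.get).map f.symm⟩

end HasPartition

namespace IsUniformizer

variable {R M : Type*} [CommRing R] [IsLocalRing R] [AddCommGroup M] [Module R M] {ϖ : R} {n : ℕ}
  (hϖ : IsUniformizer ϖ n)

include hϖ

theorem exists_torsionOf_eq [Nontrivial M] :
    ∃ x : M, ∃ a ≤ n, 1 ≤ a ∧ Ideal.torsionOf R M x = IsLocalRing.maximalIdeal R ^ a ∧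
      ∀ y : M, ϖ ^ a • y = 0 := by
  classical
  have hex : ∃ a, ∀ y : M, ϖ ^ a • y = 0 := ⟨n, fun y => by rw [hϖ.pow_self, zero_smul]⟩
  set a := Nat.find hex
  have ha : ∀ y : M, ϖ ^ a • y = 0 := Nat.find_spec hex
  have one_le : 1 ≤ a := Nat.one_le_iff_ne_zero.2 fun h0 => by
    obtain ⟨y, hy⟩ := exists_ne (0 : M)
    exact hy (by simpa [h0] using ha y)
  obtain ⟨x, hx⟩ := not_forall.1 (Nat.find_min hex (Nat.sub_one_lt_of_lt one_le))
  obtain ⟨c, hcn, hc⟩ := hϖ.exists_ideal_eq_span_pow (Ideal.torsionOf R M x)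
  have pow_smul_eq_zero_iff (b : ℕ) : ϖ ^ b • x = 0 ↔ c ≤ b := by
    rw [← Ideal.mem_torsionOf_iff, hc, Ideal.mem_span_singleton, hϖ.pow_dvd_pow_iff hcn]
  obtain rfl : c = a := le_antisymm ((pow_smul_eq_zero_iff a).1 (ha x)) <| by
    by_contra hlt
    exact hx ((pow_smul_eq_zero_iff _).2 (by omega))
  exact ⟨x, a, hcn, one_le, by rw [hc, hϖ.maximalIdeal_eq, Ideal.span_singleton_pow], ha⟩

theorem exists_isCompl_span_singleton {x : M} {a : ℕ} (ha : a ≤ n) (hM : ∀ y : M, ϖ ^ a • y = 0)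
    (hx : Ideal.torsionOf R M x = IsLocalRing.maximalIdeal R ^ a) :
    ∃ K : Submodule R M, IsCompl (Submodule.span R {x}) K := by
  have smul_eq_zero_iff {r : R} : r • x = 0 ↔ ϖ ^ a ∣ r := by
    rw [← Ideal.mem_torsionOf_iff, hx, hϖ.mem_maximalIdeal_pow]
  obtain ⟨f, hf⟩ := hϖ.exists_extension (ι := Unit) (f := LinearMap.toSpanSingleton R M x)
    (g := LinearMap.pi fun _ => LinearMap.mulRight R (ϖ ^ (n - a))) fun r hr => funext fun _ => by
      rw [LinearMap.toSpanSingleton_apply, smul_eq_zero_iff] at hr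
      change r * ϖ ^ (n - a) = 0
      rwa [mul_comm, hϖ.pow_mul_eq_zero_iff, Nat.sub_sub_self ha]
  have apply_smul (r : R) : f (r • x) () = r * ϖ ^ (n - a) := congrFun (hf r) ()
  refine ⟨LinearMap.ker f, Submodule.disjoint_def.2 fun y hy hfy => ?_,
    codisjoint_iff_le_sup.2 fun y _ => ?_⟩
  · obtain ⟨r, rfl⟩ := Submodule.mem_span_singleton.1 hy
    have h := congrFun (LinearMap.mem_ker.1 hfy) ()
    rwa [apply_smul, mul_comm, Pi.zero_apply, hϖ.pow_mul_eq_zero_iff, Nat.sub_sub_self ha,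
      ← smul_eq_zero_iff] at h
  · obtain ⟨c, hc⟩ : ϖ ^ (n - a) ∣ f y () := by
      rw [← hϖ.pow_mul_eq_zero_iff, ← smul_eq_mul, ← Pi.smul_apply, ← map_smul, hM, map_zero,
        Pi.zero_apply]
    refine Submodule.mem_sup.2 ⟨c • x, Submodule.smul_mem _ c (Submodule.mem_span_singleton_self x),
      y - c • x, funext fun _ => ?_, add_sub_cancel _ _⟩
    rw [map_sub, Pi.sub_apply, apply_smul, hc, mul_comm, sub_self, Pi.zero_apply]

theorem exists_hasPartition_le (M : Type*) [AddCommGroup M] [Module R M] [Module.Finite R M] :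
    ∃ α, HasPartition R M α ∧ ∀ b, (∀ x : M, ϖ ^ b • x = 0) → ∀ a ∈ α, a ≤ b := by
  have := hϖ.isNoetherianRing
  have := hϖ.isArtinianRing
  induction hl : Module.length R M using WellFoundedLT.induction generalizing M with
  | ind l ih =>
  cases subsingleton_or_nontrivial M
  · exact ⟨[], .of_subsingleton, by simp⟩
  obtain ⟨x, a, han, ha1, hx, ha⟩ := hϖ.exists_torsionOf_eq (M := M)
  obtain ⟨K, hK⟩ := hϖ.exists_isCompl_span_singleton han ha hx
  have a_le (b : ℕ) (hb : ϖ ^ b • x = 0) : a ≤ b := by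
    rwa [← Ideal.mem_torsionOf_iff, hx, hϖ.mem_maximalIdeal_pow, hϖ.pow_dvd_pow_iff han] at hb
  have K_ne_top : K ≠ ⊤ := by
    rintro rfl
    have hx0 : x = 0 := Submodule.span_singleton_eq_bot.1 (disjoint_top.1 hK.disjoint)
    exact absurd (a_le 0 (by rw [hx0, smul_zero])) (by omega)
  obtain ⟨α, hα, hαb⟩ := ih _ (hl ▸ Submodule.length_lt K_ne_top) K rfl
  refine ⟨a :: α, hα.cons (hαb a fun y => Subtype.ext (ha y)) ha1 (han.trans_eq
    hϖ.loewyLength_eq.symm) ?_, fun b hb => List.forall_mem_cons.2 ⟨a_le b (hb x),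
      hαb b fun y => Subtype.ext (hb y)⟩⟩
  exact (((Submodule.quotEquivOfEq _ _ hx.symm).trans
    (Ideal.quotTorsionOfEquivSpanSingleton R M x)).prodCongr (.refl R K)).trans
      (Submodule.prodEquivOfIsCompl _ _ hK)

theorem exists_hasPartition (M : Type*) [AddCommGroup M] [Module R M] [Module.Finite R M] :
    ∃ α, HasPartition R M α :=
  (hϖ.exists_hasPartition_le M).imp fun _ h => h.1

end IsUniformizer

namespace IsCyclicBasis

variable {R M N ι : Type*} [CommRing R] [AddCommGroup M] [Module R M] [AddCommGroup N] [Module R N]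
  [Fintype ι] {ϖ : R} {e : ι → M} {a : ι → ℕ} (he : IsCyclicBasis ϖ e a)

/-- The basis of `M[ϖ ^ t]` obtained from a cyclic basis of `M`. -/
def torsionBasis (t : ℕ) (j : ι) : powTorsion ϖ M t :=
  powTorsionTransition ϖ M (a j) t ⟨e j, he.pow_smul j⟩

theorem coe_linearCombination_torsionBasis {t : ℕ} (r : ι → R) :
    (Fintype.linearCombination R (he.torsionBasis t) r : M) =
      Fintype.linearCombination R e fun j => ϖ ^ (a j - t) * r j := by
  simp [Fintype.linearCombination_apply, torsionBasis, mul_smul, smul_comm (r _)]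

theorem powTorsionTransition_linearCombination {s t : ℕ} (r : ι → R) :
    powTorsionTransition ϖ M s t (Fintype.linearCombination R (he.torsionBasis s) r) =
      Fintype.linearCombination R (he.torsionBasis t)
        fun j => ϖ ^ (s - t + (a j - s) - (a j - t)) * r j := by
  refine Subtype.ext ?_
  rw [coe_powTorsionTransition, coe_linearCombination_torsionBasis,
    coe_linearCombination_torsionBasis, ← map_smul]
  congr 1
  funext j
  rw [Pi.smul_apply, smul_eq_mul, ← mul_assoc, ← mul_assoc, ← pow_add, ← pow_add]
  congr 2
  omega

theorem isCyclicBasis_torsionBasis [IsLocalRing R] {n : ℕ} (hϖ : IsUniformizer ϖ n)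
    (ha : ∀ j, a j ≤ n) (t : ℕ) :
    IsCyclicBasis ϖ (he.torsionBasis t) fun j => min (a j) t := by
  refine ⟨fun x => ?_, fun r => ?_⟩
  · obtain ⟨r, hr⟩ := he.surjective (x : M)
    have hx : ϖ ^ t • (x : M) = 0 := x.2
    rw [← hr, he.pow_smul_eq_zero_iff hϖ ha] at hx
    choose s hs using hx
    exact ⟨s, Subtype.ext <| by rw [he.coe_linearCombination_torsionBasis, ← hr, funext hs]⟩
  · rw [← Submodule.coe_eq_zero, he.coe_linearCombination_torsionBasis, he.eq_zero_iff]
    refine forall_congr' fun j => ?_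
    rw [hϖ.pow_dvd_pow_mul_iff (ha j), show a j - (a j - t) = min (a j) t by omega]

end IsCyclicBasis

section Markings

variable {R : Type*} [CommRing R] {k : Type u'} [Field k]

/-- The maps `R ⧸ ϖ ^ a → M`, modulo those that factor through free modules, form the subquotient
`M[ϖ ^ a] ⧸ ϖ ^ (n - a) M`, where `ϖ ^ n = 0`. A stable system is a family of vector spaces in
place of these subquotients, with linear maps in place of those induced by
`powTorsionTransition`. -/
structure StableSystem (k : Type u') [Field k] where
  V : ℕ → Type u'
  [addCommGroup : ∀ a, AddCommGroup (V a)]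
  [module : ∀ a, Module k (V a)]
  tr : ∀ a b, V a →ₗ[k] V b

attribute [instance] StableSystem.addCommGroup StableSystem.module

/-- An identification of the system of subquotients `M[ϖ ^ a] ⧸ ϖ ^ (n - a) M` of `M` with the
stable system `X`, given by the projections from `M[ϖ ^ a]`. -/
structure Marking (ϖ : R) (n : ℕ) (ρ : R →+* k) (M : Type*) [AddCommGroup M] [Module R M]
    (X : StableSystem k) where
  toFun : ∀ a, powTorsion ϖ M a →ₛₗ[ρ] X.V a
  surjective : ∀ a, Function.Surjective (toFun a)
  eq_zero_iff : ∀ a x, toFun a x = 0 ↔ ∃ z : M, ϖ ^ (n - a) • z = x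
  tr_apply : ∀ a b x, X.tr a b (toFun a x) = toFun b (powTorsionTransition ϖ M a b x)

/-- The stable system of `⨁ⱼ R ⧸ ϖ ^ c j`, for `c j < n ≤ 3`: in the degrees `0 < a < n`, each
nonzero summand contributes a line, spanned by the class of `ϖ ^ (c j - a)`. The exponents in `tr`
compare `ϖ ^ (a - b) * ϖ ^ (c j - a)` with `ϖ ^ (c j - b)`; so the scalars are `0` or `1`. -/
def StableSystem.standard (k : Type u') [Field k] (n : ℕ) {ι : Type} (c : ι → ℕ) :
    StableSystem k where
  V a := {j // 0 < a ∧ a < n ∧ 0 < c j} → k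
  tr a b := LinearMap.pi fun j =>
    if h : 0 < a ∧ a < n ∧ 0 < c j then
      (0 : k) ^ (a - b + (c j - a) - (c j - b)) • LinearMap.proj ⟨j, h⟩
    else 0

/-- The stable systems that are realized by finitely generated modules, in a strict form. -/
def StableSystem.IsStandard (n : ℕ) (X : StableSystem k) : Prop :=
  ∃ (s : ℕ) (c : Fin s → ℕ), (∀ j, c j < n) ∧ X = standard k n c

/-- The reduction of a vector along `ρ`, keeping the coordinates selected by `p`. -/
def coordResidue (ρ : R →+* k) {ι ι' : Type*} (p : ι' → ι) : (ι → R) →ₛₗ[ρ] (ι' → k) where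
  toFun r j := ρ (r (p j))
  map_add' _ _ := funext fun _ => map_add ρ _ _
  map_smul' _ _ := funext fun _ => map_mul ρ _ _

theorem coordResidue_surjective {ρ : R →+* k} [RingHomSurjective ρ] {ι ι' : Type*} {p : ι' → ι}
    (hp : Function.Injective p) : Function.Surjective (coordResidue ρ p) := fun y => by
  choose r hr using fun j => ρ.surjective (y j)
  exact ⟨Function.extend p r 0, funext fun j => by
    change ρ (Function.extend p r 0 (p j)) = y j
    rw [hp.extend_apply, hr]⟩

variable {ϖ : R} {n : ℕ} {ρ : R →+* k} {M N : Type*} [AddCommGroup M] [Module R M]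
  [AddCommGroup N] [Module R N]

/-- The linear maps that induce zero on the subquotients `M[ϖ ^ a] ⧸ ϖ ^ (n - a) M`; these are the
maps that factor through a free module. -/
def StablyZero (ϖ : R) (n : ℕ) (h : M →ₗ[R] N) : Prop :=
  ∀ a, ∀ x ∈ powTorsion ϖ M a, ∃ z, ϖ ^ (n - a) • z = h x

theorem StablyZero.toFun_powTorsionMap_add {Y : StableSystem k} {u : M →ₗ[R] N}
    (hu : StablyZero ϖ n u) (ν : Marking ϖ n ρ N Y) (h : M →ₗ[R] N) (a : ℕ)
    (x : powTorsion ϖ M a) :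
    ν.toFun a (powTorsionMap ϖ (h + u) a x) = ν.toFun a (powTorsionMap ϖ h a x) := by
  rw [← sub_eq_zero, ← map_sub, ν.eq_zero_iff]
  obtain ⟨z, hz⟩ := hu a x x.2
  exact ⟨z, by simp [hz]⟩

theorem StableSystem.tr_standard_coordResidue {ι : Type} {c : ι → ℕ} (hc : ∀ j, c j < n)
    (hρ : ρ ϖ = 0) (s t : ℕ) (r : ι → R) :
    (standard k n c).tr s t (coordResidue ρ Subtype.val r) =
      coordResidue ρ Subtype.val fun j => ϖ ^ (s - t + (c j - s) - (c j - t)) * r j := by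
  funext ⟨j, ht, htn, hj⟩
  change (if h : _ then _ else _ : _ →ₗ[k] k) _ = ρ (ϖ ^ _ * r j)
  rw [map_mul, map_pow, hρ]
  split_ifs with hs
  · rfl
  · have exponent_ne_zero : s - t + (c j - s) - (c j - t) ≠ 0 := by
      have := hc j
      dsimp only at hs
      omega
    rw [zero_pow exponent_ne_zero, zero_mul, LinearMap.zero_apply]

variable [IsLocalRing R]

theorem IsUniformizer.coordResidue_eq_zero_iff (hϖ : IsUniformizer ϖ n) [RingHomSurjective ρ]
    {ι ι' : Type*} {p : ι' → ι} {r : ι → R} : coordResidue ρ p r = 0 ↔ ∀ j, ϖ ∣ r (p j) :=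
  funext_iff.trans (forall_congr' fun _ => hϖ.map_eq_zero_iff ρ.surjective)

namespace IsCyclicBasis

theorem exists_torsionBasis_coordResidue {ι : Type} [Fintype ι] {e : ι → M} {a c : ι → ℕ}
    (he : IsCyclicBasis ϖ e a) (hϖ : IsUniformizer ϖ n) [RingHomSurjective ρ] (ha : ∀ j, a j ≤ n)
    (hac : ∀ j, 0 < c j → 0 < a j) (t : ℕ) :
    ∃ l : powTorsion ϖ M t →ₛₗ[ρ] (StableSystem.standard k n c).V t,
      ∀ r, l (Fintype.linearCombination R (he.torsionBasis t) r) =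
        coordResidue ρ Subtype.val r := by
  have hb := he.isCyclicBasis_torsionBasis hϖ ha t
  refine exists_comp_eq_of_ker_le (σ := RingHom.id R) (τ := ρ) hb.surjective
    fun r hr => funext fun ⟨j, ht, _, hc⟩ => (hϖ.map_eq_zero_iff ρ.surjective).2 ?_
  exact (dvd_pow_self ϖ (lt_min (hac j hc) ht).ne').trans ((hb.eq_zero_iff r).1 hr j)

theorem nonempty_marking_standard {ι : Type} [Fintype ι] {e : ι → M} {a c : ι → ℕ}
    (he : IsCyclicBasis ϖ e a) (hϖ : IsUniformizer ϖ n) [RingHomSurjective ρ] (hn : n ≤ 3)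
    (hac : ∀ j, a j = c j ∧ c j < n ∨ a j = n ∧ c j = 0) :
    Nonempty (Marking ϖ n ρ M (StableSystem.standard k n c)) := by
  have ha j : a j ≤ n := by grind
  have hb t := he.isCyclicBasis_torsionBasis hϖ ha t
  choose l hl using he.exists_torsionBasis_coordResidue (ρ := ρ) (c := c) hϖ ha
    fun j => by grind
  refine ⟨l, fun t y => ?_, fun t => (hb t).surjective.forall.2 fun r => ?_,
    fun s t => (hb s).surjective.forall.2 fun r => ?_⟩
  · obtain ⟨r, rfl⟩ := coordResidue_surjective (ρ := ρ) Subtype.val_injective y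
    exact ⟨_, hl t r⟩
  · have exponent j : min (a j) (n - t) - (a j - t) = if 0 < t ∧ t < n ∧ 0 < c j then 1 else 0 := by
      have := hac j
      split_ifs <;> omega
    rw [hl, he.coe_linearCombination_torsionBasis, he.exists_pow_smul_eq_iff]
    refine hϖ.coordResidue_eq_zero_iff.trans (Subtype.forall.trans (forall_congr' fun j => ?_))
    rw [hϖ.pow_dvd_pow_mul_iff ((min_le_left _ _).trans (ha j)), exponent]
    split_ifs with hj
    · simp only [hj, and_self, forall_const, pow_one]
    · simp only [hj, pow_zero, isUnit_one.dvd, IsEmpty.forall_iff]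
  · rw [hl, he.powTorsionTransition_linearCombination, hl,
      StableSystem.tr_standard_coordResidue (fun j => by grind [hϖ.pos])
        ((hϖ.map_eq_zero_iff ρ.surjective).2 dvd_rfl)]
    funext ⟨j, ht, htn, hc⟩
    change ρ (ϖ ^ _ * _) = ρ (ϖ ^ _ * _)
    rw [show a j = c j by grind]

end IsCyclicBasis

theorem IsUniformizer.exists_isStandard_marking (hϖ : IsUniformizer ϖ n) [RingHomSurjective ρ]
    (hn : n ≤ 3) (M : Type*) [AddCommGroup M] [Module R M] [Module.Finite R M] :
    ∃ X : StableSystem k, X.IsStandard n ∧ Nonempty (Marking ϖ n ρ M X) := by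
  obtain ⟨α, hα⟩ := hϖ.exists_hasPartition M
  obtain ⟨e, he⟩ := hα.exists_isCyclicBasis hϖ
  have bounds (j : Fin α.length) : α.get j ≤ n :=
    (hα.2.1 _ (α.get_mem j)).2.trans_eq hϖ.loewyLength_eq
  have := hϖ.pos
  refine ⟨_, ⟨_, fun j => if α.get j = n then 0 else α.get j, fun j => ?_, rfl⟩,
    he.nonempty_marking_standard hϖ hn fun j => ?_⟩ <;> grind

theorem Marking.exists_lift {X Y : StableSystem k} (μ : Marking ϖ n ρ M X) (ν : Marking ϖ n ρ N Y)
    (hϖ : IsUniformizer ϖ n) [Module.Finite R M] (φ : ∀ a, X.V a →ₗ[k] Y.V a)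
    (hφ : ∀ a b x, φ b (X.tr a b x) = Y.tr a b (φ a x)) :
    ∃ h : M →ₗ[R] N, ∀ a x, ν.toFun a (powTorsionMap ϖ h a x) = φ a (μ.toFun a x) := by
  obtain ⟨α, hα⟩ := hϖ.exists_hasPartition M
  obtain ⟨e, he⟩ := hα.exists_isCyclicBasis hϖ
  choose y hy using fun j => ν.surjective _ (φ _ (μ.toFun _ ⟨e j, he.pow_smul j⟩))
  obtain ⟨h, hh⟩ := he.exists_linearMap (fun j => (y j : N)) fun j => (y j).2
  refine ⟨h, fun t x => ?_⟩
  have hb := he.isCyclicBasis_torsionBasis hϖ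
    (fun j => (hα.2.1 _ (α.get_mem j)).2.trans_eq hϖ.loewyLength_eq) t
  refine LinearMap.congr_fun (f := (ν.toFun t).comp (powTorsionMap ϖ h t))
    (g := (φ t).comp (μ.toFun t)) (hb.linearMap_ext fun j => ?_) x
  change ν.toFun t (powTorsionMap ϖ h t (powTorsionTransition ϖ M _ t _)) =
    φ t (μ.toFun t (powTorsionTransition ϖ M _ t _))
  rw [powTorsionMap_transition, ← ν.tr_apply, ← μ.tr_apply, hφ, ← hy]
  exact congrArg _ (congrArg _ (Subtype.ext (hh j)))

theorem IsUniformizer.stablyZero_linearCombination_comp (hϖ : IsUniformizer ϖ n) {ι : Type*}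
    [Fintype ι] (v : ι → N) (l : M →ₗ[R] (ι → R)) :
    StablyZero ϖ n (Fintype.linearCombination R v ∘ₗ l) := fun a x hx => by
  have dvd j : ϖ ^ (n - a) ∣ l x j := by
    rw [← hϖ.pow_mul_eq_zero_iff, ← smul_eq_mul, ← Pi.smul_apply, ← map_smul,
      (Submodule.mem_torsionBy_iff _ _).1 hx, map_zero, Pi.zero_apply]
  choose t ht using dvd
  refine ⟨Fintype.linearCombination R v t, ?_⟩
  rw [← map_smul, LinearMap.comp_apply, funext ht]
  rfl

theorem IsUniformizer.exists_stablyZero_extension (hϖ : IsUniformizer ϖ n) {P : Type*}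
    [AddCommGroup P] [Module R P] [Module.Finite R P] {i : P →ₗ[R] M}
    (hi : Function.Injective i) {h : P →ₗ[R] N} (hh : StablyZero ϖ n h) :
    ∃ u : M →ₗ[R] N, (∀ x, u (i x) = h x) ∧ StablyZero ϖ n u := by
  obtain ⟨α, hα⟩ := hϖ.exists_hasPartition P
  obtain ⟨e, he⟩ := hα.exists_isCyclicBasis hϖ
  choose z hz using fun j => hh _ (e j) (he.pow_smul j)
  obtain ⟨b, hb⟩ := he.exists_linearMap
    (fun j => (Pi.single j (ϖ ^ (n - α.get j)) : Fin α.length → R)) fun j => by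
      rw [← Pi.single_smul, smul_eq_mul, ← pow_add, (hϖ.pow_eq_zero_iff _).2 (by omega),
        Pi.single_zero]
  obtain ⟨b', hb'⟩ := hϖ.exists_extension (f := i) (g := b) fun x hx => by
    rw [hi (hx.trans (map_zero i).symm), map_zero]
  refine ⟨Fintype.linearCombination R z ∘ₗ b', fun x => ?_,
    hϖ.stablyZero_linearCombination_comp z b'⟩
  rw [LinearMap.comp_apply, hb']
  refine LinearMap.congr_fun (f := Fintype.linearCombination R z ∘ₗ b)
    (he.linearMap_ext fun j => ?_) x
  rw [LinearMap.comp_apply, hb, Fintype.linearCombination_apply_single, hz]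

end Markings

section Vertices

variable {R : Type*} [CommRing R] [IsLocalRing R] {k : Type u'} [Field k] {ϖ : R} {n : ℕ}
  {ρ : R →+* k} {M M' N P P' : Type*} [AddCommGroup M] [Module R M] [AddCommGroup M']
  [Module R M'] [AddCommGroup N] [Module R N] [AddCommGroup P] [Module R P] [AddCommGroup P']
  [Module R P'] {Z : Type*} [AddCommGroup Z] [Module k Z]

namespace IsUniformizer

variable (hϖ : IsUniformizer ϖ n)

include hϖ

theorem injective_of_socle {h : M →ₗ[R] N} (hh : ∀ x, ϖ • x = 0 → h x = 0 → x = 0) :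
    Function.Injective h := by
  have key (a : ℕ) : ∀ x, ϖ ^ a • x = 0 → h x = 0 → x = 0 := by
    induction a with
    | zero => exact fun x hx _ => by rwa [pow_zero, one_smul] at hx
    | succ a ih =>
      intro x hx h0
      exact hh x (ih _ (by rwa [smul_smul, ← pow_succ]) (by rw [map_smul, h0, smul_zero])) h0
  exact (injective_iff_map_eq_zero h).2 fun x hx =>
    key n x (by rw [hϖ.pow_self, zero_smul]) hx

variable [RingHomSurjective ρ]

theorem pow_pred_smul_eq_zero_iff {ι : Type*} {r : ι → R} :
    ϖ ^ (n - 1) • r = 0 ↔ coordResidue ρ id r = 0 := by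
  rw [hϖ.coordResidue_eq_zero_iff, funext_iff]
  refine forall_congr' fun j => ?_
  rw [Pi.smul_apply, smul_eq_mul, Pi.zero_apply, hϖ.pow_mul_eq_zero_iff,
    Nat.sub_sub_self hϖ.pos, pow_one, id]

theorem exists_socle_extension {ι : Type*} {f : M →ₗ[R] N} {q : M →ₛₗ[ρ] (ι → k)}
    (hfq : ∀ x, f x = 0 → q x = 0) :
    ∃ l : N →ₗ[R] (ι → R), ∀ x r, coordResidue ρ id r = q x → l (f x) = ϖ ^ (n - 1) • r := by
  obtain ⟨l, hl⟩ := hϖ.exists_extension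
    (M := LinearMap.eqLocus ((coordResidue ρ id).comp (LinearMap.snd R M (ι → R)))
      (q.comp (LinearMap.fst R M (ι → R))))
    (f := f ∘ₗ LinearMap.fst R M (ι → R) ∘ₗ Submodule.subtype _)
    (g := ϖ ^ (n - 1) • LinearMap.snd R M (ι → R) ∘ₗ Submodule.subtype _)
    fun ⟨⟨x, r⟩, hr⟩ hx => hϖ.pow_pred_smul_eq_zero_iff.2 ((show _ = q x from hr).trans (hfq x hx))
  exact ⟨l, fun x r hr => hl ⟨(x, r), hr⟩⟩

theorem exists_residue_lift {ι : Type*} {i : P →ₗ[R] M} {q : M →ₛₗ[ρ] (ι → k)}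
    (hiq : ∀ x y, i y = ϖ ^ (n - 1) • x → q x = 0) :
    ∃ l : M →ₗ[R] (ι → R), (∀ y, l (i y) = 0) ∧ ∀ x, coordResidue ρ id (l x) = q x := by
  obtain ⟨l, hl⟩ := hϖ.exists_socle_extension
    (f := (LinearMap.range i).mkQ ∘ₗ LinearMap.lsmul R M (ϖ ^ (n - 1))) (q := q) fun x hx => by
      obtain ⟨y, hy⟩ := (Submodule.Quotient.mk_eq_zero _).1 hx
      exact hiq x y hy
  refine ⟨l ∘ₗ (LinearMap.range i).mkQ, fun y => ?_, fun x => ?_⟩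
  · rw [LinearMap.comp_apply, Submodule.mkQ_apply,
      (Submodule.Quotient.mk_eq_zero _).2 (LinearMap.mem_range_self i y), map_zero]
  · obtain ⟨r, hr⟩ := coordResidue_surjective (ρ := ρ) Function.injective_id (q x)
    rw [← hr, ← sub_eq_zero, ← map_sub, ← hϖ.pow_pred_smul_eq_zero_iff, smul_sub, sub_eq_zero,
      ← hl x r hr, LinearMap.comp_apply, LinearMap.comp_apply, LinearMap.lsmul_apply, map_smul,
      map_smul]

theorem exists_stablyZero_lift [Module.Finite k Z] {i : P →ₗ[R] M} {γ : N →ₛₗ[ρ] Z}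
    (hγ : Function.Surjective γ) {δ : M →ₛₗ[ρ] Z}
    (hδ : ∀ x y, i y = ϖ ^ (n - 1) • x → δ x = 0) :
    ∃ w : M →ₗ[R] N, StablyZero ϖ n w ∧ (∀ y, w (i y) = 0) ∧ ∀ x, γ (w x) = δ x := by
  let b := Module.finBasis k Z
  obtain ⟨l, hli, hl⟩ := hϖ.exists_residue_lift (i := i)
    (q := b.equivFun.toLinearMap.comp δ) fun x y hxy => by
      rw [LinearMap.comp_apply, hδ x y hxy, map_zero]
  choose v hv using fun j => hγ (b j)
  refine ⟨_, hϖ.stablyZero_linearCombination_comp v l, fun y => ?_, fun x => ?_⟩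
  · rw [LinearMap.comp_apply, hli, map_zero]
  · rw [LinearMap.comp_apply, Fintype.linearCombination_apply, map_sum, ← b.sum_equivFun (δ x)]
    refine Finset.sum_congr rfl fun j _ => ?_
    rw [map_smulₛₗ, hv]
    exact congrArg (· • b j) (congrFun (hl x) j)

theorem exists_coordinates [Module.Finite R M] (hM : ∀ x : M, ϖ • x = 0) :
    ∃ (d : ℕ) (f : M →ₛₗ[ρ] (Fin d → k)), Function.Bijective f := by
  obtain ⟨α, hα, hα1⟩ := hϖ.exists_hasPartition_le M
  obtain ⟨e, he⟩ := hα.exists_isCyclicBasis hϖ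
  have get_eq_one j : α.get j = 1 :=
    le_antisymm (hα1 1 (by simpa using hM) _ (α.get_mem j)) (hα.2.1 _ (α.get_mem j)).1
  have ker_iff (r) : Fintype.linearCombination R e r = 0 ↔ coordResidue ρ id r = 0 := by
    simp only [he.eq_zero_iff, hϖ.coordResidue_eq_zero_iff, get_eq_one, pow_one, id]
  obtain ⟨f, hf⟩ := exists_comp_eq_of_ker_le (σ := RingHom.id R) (τ := ρ) he.surjective
    fun r => (ker_iff r).1
  refine ⟨_, f, (injective_iff_map_eq_zero f).2 (he.surjective.forall.2 fun r hr => ?_),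
    fun y => ?_⟩
  · rwa [ker_iff, ← hf]
  · obtain ⟨r, rfl⟩ := coordResidue_surjective (ρ := ρ) Function.injective_id y
    exact ⟨_, hf r⟩

end IsUniformizer

/-- An identification with `Z` of the quotient of `M` by `{x | ϖ ^ (n - 1) • x ∈ range i}`, which
is isomorphic to `ϖ ^ (n - 1) • coker i`. The dimension of `Z` is thus the number of free summands
of the cokernel of `i`, which the stable subquotients of `M` do not see. -/
structure IsCokernelMarking (ϖ : R) (n : ℕ) (i : P →ₗ[R] M) (γ : M →ₛₗ[ρ] Z) : Prop where
  surjective : Function.Surjective γ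
  eq_zero_iff : ∀ x, γ x = 0 ↔ ∃ y, i y = ϖ ^ (n - 1) • x

theorem IsUniformizer.exists_isCokernelMarking [Module.Finite R M] [RingHomSurjective ρ]
    (hϖ : IsUniformizer ϖ n) (i : P →ₗ[R] M) :
    ∃ (d : ℕ) (γ : M →ₛₗ[ρ] (Fin d → k)), IsCokernelMarking ϖ n i γ := by
  let K := (LinearMap.range i).comap (LinearMap.lsmul R M (ϖ ^ (n - 1)))
  obtain ⟨d, f, hf⟩ := hϖ.exists_coordinates (ρ := ρ) (M := M ⧸ K) <|
    K.mkQ_surjective.forall.2 fun x => by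
      rw [← map_smul, Submodule.mkQ_apply, Submodule.Quotient.mk_eq_zero]
      refine ⟨0, ?_⟩
      rw [map_zero, LinearMap.lsmul_apply, smul_smul, ← pow_succ, Nat.sub_add_cancel hϖ.pos,
        hϖ.pow_self, zero_smul]
  refine ⟨d, f.comp K.mkQ, hf.surjective.comp K.mkQ_surjective, fun x => ?_⟩
  rw [LinearMap.comp_apply, _root_.map_eq_zero_iff f hf.injective, Submodule.mkQ_apply,
    Submodule.Quotient.mk_eq_zero]
  rfl

namespace Marking

variable {X Y : StableSystem k}

theorem exists_extension (μ : Marking ϖ n ρ M X) (ν : Marking ϖ n ρ N Y) (hϖ : IsUniformizer ϖ n)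
    [Module.Finite R M] [Module.Finite R P] {φ : ∀ a, X.V a →ₗ[k] Y.V a}
    (hφ : ∀ a b x, φ b (X.tr a b x) = Y.tr a b (φ a x)) {i : P →ₗ[R] M}
    (hi : Function.Injective i) {f : P →ₗ[R] N}
    (hf : ∀ a y, ν.toFun a (powTorsionMap ϖ f a y) = φ a (μ.toFun a (powTorsionMap ϖ i a y))) :
    ∃ h : M →ₗ[R] N, (∀ y, h (i y) = f y) ∧
      ∀ a x, ν.toFun a (powTorsionMap ϖ h a x) = φ a (μ.toFun a x) := by
  obtain ⟨h, hh⟩ := μ.exists_lift ν hϖ φ hφ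
  obtain ⟨u, hu, hu0⟩ := hϖ.exists_stablyZero_extension hi (h := f - h ∘ₗ i) fun a y hy => by
    refine (ν.eq_zero_iff a (powTorsionMap ϖ f a ⟨y, hy⟩ -
      powTorsionMap ϖ h a (powTorsionMap ϖ i a ⟨y, hy⟩))).1 ?_
    rw [map_sub, hf, hh, sub_self]
  refine ⟨h + u, fun y => ?_, fun a x => ?_⟩
  · rw [LinearMap.add_apply, hu, LinearMap.sub_apply, LinearMap.comp_apply, add_sub_cancel]
  · rw [hu0.toFun_powTorsionMap_add ν h, hh]

theorem injective_of_comm (μ : Marking ϖ n ρ M X) (μ' : Marking ϖ n ρ M' X)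
    (hϖ : IsUniformizer ϖ n) {i : P →ₗ[R] M} {γ : M →ₛₗ[ρ] Z} (hγ : IsCokernelMarking ϖ n i γ)
    {i' : P' →ₗ[R] M'} {γ' : M' →ₛₗ[ρ] Z} (hγ' : IsCokernelMarking ϖ n i' γ')
    (hi' : Function.Injective i') {G : P →ₗ[R] P'} (hG : Function.Injective G) {g : M →ₗ[R] M'}
    (hg : ∀ y, g (i y) = i' (G y)) (hgμ : ∀ x, μ'.toFun 1 (powTorsionMap ϖ g 1 x) = μ.toFun 1 x)
    (hgγ : ∀ x, γ' (g x) = γ x) : Function.Injective g := by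
  refine hϖ.injective_of_socle fun x hx hgx => ?_
  have hgx' : powTorsionMap ϖ g 1 ⟨x, by simpa using hx⟩ = 0 := Subtype.ext hgx
  obtain ⟨z, hz⟩ := (μ.eq_zero_iff 1 _).1 (by rw [← hgμ, hgx', map_zero])
  have hγz : γ z = 0 := by
    rw [← hgγ, hγ'.eq_zero_iff]
    exact ⟨0, by rw [map_zero, ← map_smul, hz, hgx]⟩
  obtain ⟨y, hy⟩ := (hγ.eq_zero_iff z).1 hγz
  obtain rfl : i y = x := hy.trans hz
  rw [hg, ← map_zero i', hi'.eq_iff] at hgx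
  rw [hG (hgx.trans (map_zero G).symm), map_zero]

theorem exists_injective_lift (μ : Marking ϖ n ρ M X) (μ' : Marking ϖ n ρ M' X)
    (hϖ : IsUniformizer ϖ n) [RingHomSurjective ρ] [Module.Finite R M] [Module.Finite R P]
    {i : P →ₗ[R] M} {γ : M →ₛₗ[ρ] Z} (hγ : IsCokernelMarking ϖ n i γ)
    (hi : Function.Injective i) {i' : P' →ₗ[R] M'} {γ' : M' →ₛₗ[ρ] Z}
    (hγ' : IsCokernelMarking ϖ n i' γ') (hi' : Function.Injective i') {G : P →ₗ[R] P'}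
    (hG : Function.Injective G)
    (hμ : ∀ a y, μ'.toFun a (powTorsionMap ϖ (i' ∘ₗ G) a y) =
      μ.toFun a (powTorsionMap ϖ i a y)) :
    ∃ g : M →ₗ[R] M', Function.Injective g ∧ (∀ y, g (i y) = i' (G y)) ∧
      ∀ a x, μ'.toFun a (powTorsionMap ϖ g a x) = μ.toFun a x := by
  have : Module.Finite k Z := .of_surjective γ hγ.surjective
  obtain ⟨h, hhi, hhμ⟩ := μ.exists_extension μ' hϖ (φ := fun _ => LinearMap.id)
    (fun _ _ _ => rfl) hi hμ
  obtain ⟨w, hw, hwi, hwγ⟩ := hϖ.exists_stablyZero_lift (i := i) hγ'.surjective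
    (δ := γ - γ'.comp h) fun x y hxy => by
      rw [LinearMap.sub_apply, (hγ.eq_zero_iff x).2 ⟨y, hxy⟩, LinearMap.comp_apply,
        (hγ'.eq_zero_iff _).2 ⟨G y, by rw [← map_smul, ← hxy, hhi]; rfl⟩, sub_zero]
  have hgi y : (h + w) (i y) = i' (G y) := by
    rw [LinearMap.add_apply, hwi, add_zero, hhi]
    rfl
  have hgμ a x : μ'.toFun a (powTorsionMap ϖ (h + w) a x) = μ.toFun a x := by
    rw [hw.toFun_powTorsionMap_add μ' h, hhμ]
    rfl
  refine ⟨h + w, μ.injective_of_comm μ' hϖ hγ hγ' hi' hG hgi (hgμ 1) fun x => ?_, hgi, hgμ⟩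
  rw [LinearMap.add_apply, map_add, hwγ, LinearMap.sub_apply, LinearMap.comp_apply,
    add_sub_cancel]

theorem exists_equiv_lift (μ : Marking ϖ n ρ M X) (μ' : Marking ϖ n ρ M' X)
    (hϖ : IsUniformizer ϖ n) [RingHomSurjective ρ] [Module.Finite R M] [Module.Finite R M']
    [Module.Finite R P] [Module.Finite R P'] {i : P →ₗ[R] M}
    {γ : M →ₛₗ[ρ] Z} (hγ : IsCokernelMarking ϖ n i γ) (hi : Function.Injective i)
    {i' : P' →ₗ[R] M'} {γ' : M' →ₛₗ[ρ] Z} (hγ' : IsCokernelMarking ϖ n i' γ')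
    (hi' : Function.Injective i') (G : P ≃ₗ[R] P')
    (hμ : ∀ a y, μ'.toFun a (powTorsionMap ϖ (i' ∘ₗ (G : P →ₗ[R] P')) a y) =
      μ.toFun a (powTorsionMap ϖ i a y)) :
    ∃ g : M ≃ₗ[R] M', (∀ y, g (i y) = i' (G y)) ∧
      ∀ a x, μ'.toFun a (powTorsionMap ϖ (g : M →ₗ[R] M') a x) = μ.toFun a x := by
  obtain ⟨g, hg, hgi, hgμ⟩ := μ.exists_injective_lift μ' hϖ hγ hi hγ' hi' G.injective hμ
  obtain ⟨g', hg', -⟩ := μ'.exists_injective_lift μ hϖ hγ' hi' hγ hi (G := G.symm)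
    G.symm.injective fun a y => by
      have hy : powTorsionMap ϖ (i' ∘ₗ (G : P →ₗ[R] P')) a
          (powTorsionMap ϖ (G.symm : P' →ₗ[R] P) a y) = powTorsionMap ϖ i' a y :=
        Subtype.ext (congrArg i' (G.apply_symm_apply y))
      rw [← hy, hμ]
      rfl
  have := hϖ.isArtinianRing
  have surjective : Function.Surjective (g ∘ₗ g') :=
    IsArtinian.surjective_of_injective_endomorphism (g ∘ₗ g') (hg.comp hg')
  exact ⟨LinearEquiv.ofBijective g ⟨hg, Function.Surjective.of_comp surjective⟩, hgi, hgμ⟩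

end Marking

end Vertices

section Realization

variable {R : Type u} [CommRing R] [IsLocalRing R] {k : Type u'} [Field k] {ϖ : R} {n : ℕ}
  {ρ : R →+* k}

/-- Adding a free summand to a module does not change its stable subquotients. -/
def Marking.prodFree {N : Type*} [AddCommGroup N] [Module R N] {X : StableSystem k}
    (μ : Marking ϖ n ρ N X) (hϖ : IsUniformizer ϖ n) (ι : Type*) :
    Marking ϖ n ρ (N × (ι → R)) X where
  toFun a := (μ.toFun a).comp (powTorsionMap ϖ (LinearMap.fst R N (ι → R)) a)
  surjective a := (μ.surjective a).comp fun x =>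
    ⟨powTorsionMap ϖ (LinearMap.inl R N (ι → R)) a x, rfl⟩
  eq_zero_iff a x := by
    refine (μ.eq_zero_iff a _).trans ⟨fun ⟨z, hz⟩ => ?_, fun ⟨z, hz⟩ => ⟨z.1, congrArg Prod.fst hz⟩⟩
    have dvd j : ϖ ^ (n - a) ∣ x.1.2 j :=
      hϖ.pow_mul_eq_zero_iff.1 (congrFun (congrArg Prod.snd x.2) j)
    choose t ht using dvd
    exact ⟨(z, t), Prod.ext hz (funext ht).symm⟩
  tr_apply a b x := by
    rw [LinearMap.comp_apply, LinearMap.comp_apply, μ.tr_apply, powTorsionMap_transition]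

/-- A finitely generated module with a marking by `X`, in the universe of the ring. -/
structure MarkedModule (ϖ : R) (n : ℕ) (ρ : R →+* k) (X : StableSystem k) where
  carrier : Type u
  [addCommGroup : AddCommGroup carrier]
  [module : Module R carrier]
  [finite : Module.Finite R carrier]
  mark : Marking ϖ n ρ carrier X

attribute [instance] MarkedModule.addCommGroup MarkedModule.module MarkedModule.finite

namespace IsUniformizer

variable (hϖ : IsUniformizer ϖ n)

include hϖ

theorem exists_markedModule [RingHomSurjective ρ] (hn : n ≤ 3) {X : StableSystem k}
    (hX : X.IsStandard n) : ∃ N : MarkedModule ϖ n ρ X, ∀ x : N.carrier, ϖ ^ (n - 1) • x = 0 := by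
  obtain ⟨s, c, hc, rfl⟩ := hX
  have he := hϖ.isCyclicBasis_single c
  obtain ⟨μ⟩ := he.nonempty_marking_standard (ρ := ρ) hϖ hn fun j => Or.inl ⟨rfl, hc j⟩
  refine ⟨⟨_, μ⟩, he.surjective.forall.2 fun r => ?_⟩
  rw [he.pow_smul_eq_zero_iff hϖ fun j => (hc j).le]
  intro j
  rw [Nat.sub_eq_zero_of_le (Nat.le_sub_one_of_lt (hc j)), pow_zero]
  exact one_dvd _

theorem exists_injective_prod {P N : Type*} [AddCommGroup P] [Module R P] [Module.Finite R P]
    [AddCommGroup N] [Module R N] (h : P →ₗ[R] N) (hN : ∀ x : N, ϖ ^ (n - 1) • x = 0) :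
    ∃ (d : ℕ) (e : P →ₗ[R] (Fin d → R)), Function.Injective (h.prod e) ∧
      ∀ x, ∃ y, h.prod e y = ϖ ^ (n - 1) • x := by
  have := hϖ.isNoetherianRing
  have : RingHomSurjective (IsLocalRing.residue R) := ⟨IsLocalRing.residue_surjective⟩
  obtain ⟨d, f, hf⟩ := hϖ.exists_coordinates (ρ := IsLocalRing.residue R)
    (M := (LinearMap.ker h ⊓ LinearMap.ker (LinearMap.lsmul R P ϖ) : Submodule R P))
    fun x => Subtype.ext x.2.2
  obtain ⟨e, he⟩ := hϖ.exists_socle_extension (f := Submodule.subtype _) (q := f) fun x hx => by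
    rw [show x = 0 from Subtype.ext hx, map_zero]
  refine ⟨d, e, hϖ.injective_of_socle fun x hx h0 => ?_, fun x => ?_⟩
  · obtain ⟨r, hr⟩ := coordResidue_surjective (ρ := IsLocalRing.residue R) Function.injective_id
      (f ⟨x, congrArg Prod.fst h0, hx⟩)
    have hr0 : coordResidue (IsLocalRing.residue R) id r = 0 := by
      rw [← hϖ.pow_pred_smul_eq_zero_iff, ← he _ r hr]
      exact congrArg Prod.snd h0
    exact congrArg Subtype.val (hf.injective (hr.symm.trans (hr0.trans (map_zero f).symm)))
  · obtain ⟨y, hy⟩ := hf.surjective (coordResidue _ id x.2)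
    exact ⟨y, Prod.ext (y.2.1.trans (hN x.1).symm) (he y x.2 hy.symm)⟩

theorem isCokernelMarking_prod_zero [RingHomSurjective ρ] {P N Z ι : Type*} [AddCommGroup P]
    [Module R P] [AddCommGroup N] [Module R N] [AddCommGroup Z] [Module k Z] [Finite ι]
    {i : P →ₗ[R] N} (hi : ∀ x, ∃ y, i y = ϖ ^ (n - 1) • x) (b : Module.Basis ι k Z) :
    IsCokernelMarking ϖ n (i.prod (0 : P →ₗ[R] (ι → R)))
      ((b.equivFun.symm.toLinearMap.comp (coordResidue ρ id)).comp
        (LinearMap.snd R N (ι → R))) := by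
  refine ⟨(b.equivFun.symm.surjective.comp
    (coordResidue_surjective Function.injective_id)).comp Prod.snd_surjective, fun x => ?_⟩
  have eq_zero_iff : b.equivFun.symm (coordResidue ρ id x.2) = 0 ↔ ϖ ^ (n - 1) • x.2 = 0 := by
    rw [LinearEquiv.map_eq_zero_iff, ← hϖ.pow_pred_smul_eq_zero_iff]
  refine eq_zero_iff.trans ⟨fun hx => ?_, fun ⟨y, hy⟩ => (congrArg Prod.snd hy).symm⟩
  obtain ⟨y, hy⟩ := hi x.1
  exact ⟨y, Prod.ext hy hx.symm⟩

end IsUniformizer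

theorem MarkedModule.exists_isCokernelMarking [RingHomSurjective ρ] {X : StableSystem k}
    (N : MarkedModule ϖ n ρ X) (hϖ : IsUniformizer ϖ n) (hN : ∀ x : N.carrier, ϖ ^ (n - 1) • x = 0)
    {P Z : Type*} [AddCommGroup P] [Module R P] [Module.Finite R P] (h : P →ₗ[R] N.carrier)
    [AddCommGroup Z] [Module k Z] [Module.Finite k Z] :
    ∃ (M : MarkedModule ϖ n ρ X) (i : P →ₗ[R] M.carrier) (γ : M.carrier →ₛₗ[ρ] Z),
      Function.Injective i ∧ IsCokernelMarking ϖ n i γ ∧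
      ∀ a y, M.mark.toFun a (powTorsionMap ϖ i a y) = N.mark.toFun a (powTorsionMap ϖ h a y) := by
  obtain ⟨d, e, he, hrange⟩ := hϖ.exists_injective_prod h hN
  exact ⟨⟨_, (N.mark.prodFree hϖ (Fin d)).prodFree hϖ (Fin (Module.finrank k Z))⟩, _, _,
    fun x y hxy => he (congrArg Prod.fst hxy),
    hϖ.isCokernelMarking_prod_zero hrange (Module.finBasis k Z), fun _ _ => rfl⟩

end Realization

section Acyclic

variable {Q : Type*} [Quiver Q] [Finite Q] (hQ : Quiver.IsAcyclic Q)

include hQ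

theorem wellFounded_nonempty_hom_of_isAcyclic :
    WellFounded fun j i : Q => Nonempty (j ⟶ i) := by
  let r (j i : Q) : Prop := ∃ p : Quiver.Path j i, p.length ≠ 0
  have : Std.Irrefl r := ⟨fun i ⟨p, hp⟩ => hp (hQ i p)⟩
  have : IsTrans Q r := ⟨fun _ _ _ ⟨p, hp⟩ ⟨q, _⟩ => ⟨p.comp q, by
    rw [Quiver.Path.length_comp]
    exact fun h => hp (Nat.add_eq_zero_iff.1 h).1⟩⟩
  refine Subrelation.wf (fun ⟨f⟩ => ?_) (Finite.wellFounded_of_trans_of_irrefl r)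
  exact ⟨f.toPath, one_ne_zero⟩

theorem exists_forall_of_isAcyclic {T : Q → Type*}
    {S : ∀ i, (∀ f : (Σ j : Q, (j ⟶ i)), T f.1) → T i → Prop} (h : ∀ i t, ∃ t', S i t t') :
    ∃ t : ∀ i, T i, ∀ i, S i (fun f => t f.1) (t i) := by
  choose F hF using h
  refine ⟨(wellFounded_nonempty_hom_of_isAcyclic hQ).fix
    fun i t => F i fun f => t f.1 ⟨f.2⟩, fun i => ?_⟩
  rw [WellFounded.fix_eq]
  exact hF i _

end Acyclic

namespace QuiverRep

variable {Q : Type w} [Quiver.{w'} Q] [Fintype Q] [∀ i j : Q, Fintype (i ⟶ j)]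
  {R : Type u} [CommRing R]

theorem inMap_apply (M : QuiverRep Q R) {i : Q} (y : ∀ f : (Σ j : Q, (j ⟶ i)), M.obj f.1) :
    M.inMap i y = ∑ f : (Σ j : Q, (j ⟶ i)), M.map f.2 (y f) := by
  simp only [inMap, LinearMap.sum_apply, LinearMap.comp_apply, LinearMap.proj_apply]

theorem inMap_single [∀ j, DecidableEq (Σ i : Q, (i ⟶ j))] (M : QuiverRep Q R) {i j : Q}
    (f : i ⟶ j) (x : M.obj i) :
    M.inMap j (Pi.single (M := fun f : (Σ i : Q, (i ⟶ j)) => M.obj f.1) ⟨i, f⟩ x) =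
      M.map f x := by
  rw [inMap_apply, Fintype.sum_eq_single ⟨i, f⟩ fun g hg => by
    rw [Pi.single_eq_of_ne hg, map_zero], Pi.single_eq_same]

theorem inMap_directSum {M N : QuiverRep Q R} {i : Q}
    (y : ∀ f : (Σ j : Q, (j ⟶ i)), M.obj f.1) (z : ∀ f : (Σ j : Q, (j ⟶ i)), N.obj f.1) :
    (M.directSum N).inMap i (fun f => (y f, z f)) = (M.inMap i y, N.inMap i z) := by
  refine ((M.directSum N).inMap_apply _).trans ?_
  rw [inMap_apply, inMap_apply]
  exact Prod.ext (map_sum (LinearMap.fst R _ _) _ _) (map_sum (LinearMap.snd R _ _) _ _)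

theorem IsMono.directSum {M N : QuiverRep Q R} (hM : M.IsMono) (hN : N.IsMono) :
    (M.directSum N).IsMono := fun i y z h => by
  have h' := (inMap_directSum (fun f => (y f).1) fun f => (y f).2).symm.trans
    (h.trans (inMap_directSum (fun f => (z f).1) fun f => (z f).2))
  funext f
  exact Prod.ext (congrFun (hM i (congrArg Prod.fst h')) f)
    (congrFun (hN i (congrArg Prod.snd h')) f)

theorem Iso.equiv_inMap {M N : QuiverRep Q R} (e : M.Iso N) {i : Q}
    (y : ∀ f : (Σ j : Q, (j ⟶ i)), M.obj f.1) :
    e.equiv i (M.inMap i y) = N.inMap i fun f => e.equiv f.1 (y f) := by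
  rw [inMap_apply, inMap_apply, map_sum]
  exact Finset.sum_congr rfl fun _ _ => e.comm _ _

end QuiverRep

section StableReps

variable {R : Type u} [CommRing R] {k : Type u'} [Field k] {ϖ : R} {n : ℕ} {ρ : R →+* k}

/-- `LinearMap.prodMap` for semilinear maps. -/
def semilinearProdMap {A B C D : Type*} [AddCommGroup A] [Module R A] [AddCommGroup B] [Module k B]
    [AddCommGroup C] [Module R C] [AddCommGroup D] [Module k D] (f : A →ₛₗ[ρ] B)
    (g : C →ₛₗ[ρ] D) : A × C →ₛₗ[ρ] B × D where
  toFun := Prod.map f g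
  map_add' _ _ := Prod.ext (map_add f _ _) (map_add g _ _)
  map_smul' _ _ := Prod.ext (map_smulₛₗ f _ _) (map_smulₛₗ g _ _)

/-- The direct sum of two stable systems. -/
def StableSystem.prod (X Y : StableSystem k) : StableSystem k where
  V a := X.V a × Y.V a
  tr a b := (X.tr a b).prodMap (Y.tr a b)

namespace Marking

variable {M N : Type*} [AddCommGroup M] [Module R M] [AddCommGroup N] [Module R N]
  {X Y : StableSystem k}

theorem exists_linearEquiv (μ : Marking ϖ n ρ M X) [RingHomSurjective ρ] (ν : Marking ϖ n ρ M Y)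
    (a : ℕ) : ∃ e : X.V a ≃ₗ[k] Y.V a, ∀ x, e (μ.toFun a x) = ν.toFun a x :=
  exists_linearEquiv_of_ker_eq (μ.surjective a) (ν.surjective a)
    fun x => (μ.eq_zero_iff a x).trans (ν.eq_zero_iff a x).symm

theorem exists_linearMap (μ : Marking ϖ n ρ M X) [RingHomSurjective ρ] (ν : Marking ϖ n ρ N Y)
    (h : M →ₗ[R] N) (a : ℕ) :
    ∃ φ : X.V a →ₗ[k] Y.V a, ∀ x, φ (μ.toFun a x) = ν.toFun a (powTorsionMap ϖ h a x) := by
  refine exists_comp_eq_of_ker_le (μ.surjective a) (g := (ν.toFun a).comp (powTorsionMap ϖ h a))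
    fun x hx => (ν.eq_zero_iff a _).2 ?_
  obtain ⟨z, hz⟩ := (μ.eq_zero_iff a x).1 hx
  exact ⟨h z, by rw [← map_smul, hz, coe_powTorsionMap]⟩

/-- Transport of a marking along an isomorphism. -/
def ofEquiv (μ : Marking ϖ n ρ M X) (e : N ≃ₗ[R] M) : Marking ϖ n ρ N X where
  toFun a := (μ.toFun a).comp (powTorsionMap ϖ (e : N →ₗ[R] M) a)
  surjective a := (μ.surjective a).comp fun x =>
    ⟨powTorsionMap ϖ (e.symm : M →ₗ[R] N) a x, Subtype.ext (e.apply_symm_apply x)⟩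
  eq_zero_iff a x := by
    rw [LinearMap.comp_apply, μ.eq_zero_iff, e.surjective.exists]
    exact exists_congr fun z => by
      rw [← map_smul, coe_powTorsionMap, LinearEquiv.coe_coe, e.injective.eq_iff]
  tr_apply a b x := by
    rw [LinearMap.comp_apply, LinearMap.comp_apply, μ.tr_apply, powTorsionMap_transition]

/-- The marking of a direct sum. -/
def prod (μ : Marking ϖ n ρ M X) (ν : Marking ϖ n ρ N Y) :
    Marking ϖ n ρ (M × N) (X.prod Y) where
  toFun a := (semilinearProdMap (μ.toFun a) (ν.toFun a)).comp
    ((powTorsionMap ϖ (LinearMap.fst R M N) a).prod (powTorsionMap ϖ (LinearMap.snd R M N) a))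
  surjective a := ((μ.surjective a).prodMap (ν.surjective a)).comp fun x =>
    ⟨⟨(x.1, x.2), Prod.ext x.1.2 x.2.2⟩, rfl⟩
  eq_zero_iff a x := by
    refine Prod.ext_iff.trans ((and_congr (μ.eq_zero_iff a _) (ν.eq_zero_iff a _)).trans
      ⟨fun ⟨⟨y, hy⟩, ⟨z, hz⟩⟩ => ?_, fun ⟨z, hz⟩ => ?_⟩)
    · exact ⟨(y, z), Prod.ext hy hz⟩
    · exact ⟨⟨z.1, congrArg Prod.fst hz⟩, ⟨z.2, congrArg Prod.snd hz⟩⟩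
  tr_apply a b _ := Prod.ext (μ.tr_apply a b _) (ν.tr_apply a b _)

end Marking

/-- Representations of a quiver in the category of stable systems. The additional vector spaces
`Z i` record the free summands of the cokernels of the maps `QuiverRep.inMap`. -/
structure StableRep (Q : Type w) [Quiver.{w'} Q] (k : Type u') [Field k] where
  obj : Q → StableSystem k
  Z : Q → Type u'
  [addCommGroup : ∀ i, AddCommGroup (Z i)]
  [module : ∀ i, Module k (Z i)]
  map : ∀ {i j : Q}, (i ⟶ j) → ∀ a, (obj i).V a →ₗ[k] (obj j).V a
  map_tr : ∀ {i j : Q} (f : i ⟶ j) a b x,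
    map f b ((obj i).tr a b x) = (obj j).tr a b (map f a x)

attribute [instance] StableRep.addCommGroup StableRep.module

variable {Q : Type w} [Quiver.{w'} Q]

namespace StableRep

/-- Isomorphisms of stable representations. -/
structure Iso (X Y : StableRep Q k) where
  equiv : ∀ i a, (X.obj i).V a ≃ₗ[k] (Y.obj i).V a
  equivZ : ∀ i, X.Z i ≃ₗ[k] Y.Z i
  tr_equiv : ∀ i a b x, (Y.obj i).tr a b (equiv i a x) = equiv i b ((X.obj i).tr a b x)
  map_equiv : ∀ {i j : Q} (f : i ⟶ j) a x, Y.map f a (equiv i a x) = equiv j a (X.map f a x)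

/-- The direct sum of two stable representations. -/
def directSum (X Y : StableRep Q k) : StableRep Q k where
  obj i := (X.obj i).prod (Y.obj i)
  Z i := X.Z i × Y.Z i
  map f a := (X.map f a).prodMap (Y.map f a)
  map_tr f a b x := Prod.ext (X.map_tr f a b x.1) (Y.map_tr f a b x.2)

end StableRep

variable [Fintype Q] [∀ i j : Q, Fintype (i ⟶ j)]

namespace StableRep

/-- The analogue of `QuiverRep.inMap`. -/
def inMap (X : StableRep Q k) (i : Q) (a : ℕ) :
    (∀ f : (Σ j : Q, (j ⟶ i)), (X.obj f.1).V a) →ₗ[k] (X.obj i).V a :=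
  ∑ f : (Σ j : Q, (j ⟶ i)), (X.map f.2 a).comp (LinearMap.proj f)

theorem inMap_apply (X : StableRep Q k) {i : Q} {a : ℕ}
    (y : ∀ f : (Σ j : Q, (j ⟶ i)), (X.obj f.1).V a) :
    X.inMap i a y = ∑ f : (Σ j : Q, (j ⟶ i)), X.map f.2 a (y f) := by
  simp only [inMap, LinearMap.sum_apply, LinearMap.comp_apply, LinearMap.proj_apply]

end StableRep

/-- An identification with `X` of the stable representation determined by `M`. -/
structure RepMarking (ϖ : R) (n : ℕ) (ρ : R →+* k) (M : QuiverRep Q R) (X : StableRep Q k) where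
  mark : ∀ i, Marking ϖ n ρ (M.obj i) (X.obj i)
  γ : ∀ i, M.obj i →ₛₗ[ρ] X.Z i
  isCokernelMarking : ∀ i, IsCokernelMarking ϖ n (M.inMap i) (γ i)
  map_mark : ∀ {i j : Q} (f : i ⟶ j) a x,
    X.map f a ((mark i).toFun a x) = (mark j).toFun a (powTorsionMap ϖ (M.map f) a x)

theorem exists_repMarking [IsLocalRing R] (hϖ : IsUniformizer ϖ n) [RingHomSurjective ρ]
    (hn : n ≤ 3) (M : QuiverRep Q R) :
    ∃ X : StableRep Q k, (∀ i, (X.obj i).IsStandard n) ∧ Nonempty (RepMarking ϖ n ρ M X) := by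
  choose X hX μ using fun i => hϖ.exists_isStandard_marking (ρ := ρ) hn (M.obj i)
  replace μ i := (μ i).some
  choose d γ hγ using fun i => hϖ.exists_isCokernelMarking (ρ := ρ) (M.inMap i)
  choose φ hφ using fun {i j : Q} (f : i ⟶ j) => (μ i).exists_linearMap (μ j) (M.map f)
  refine ⟨⟨X, fun i => Fin (d i) → k, φ, fun {i j} f a b => ?_⟩, hX, ⟨μ, γ, hγ, hφ⟩⟩
  refine ((μ i).surjective a).forall.2 fun x => ?_
  rw [(μ i).tr_apply, hφ, hφ, (μ j).tr_apply, powTorsionMap_transition]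

namespace RepMarking

variable {M N : QuiverRep Q R} {X Y : StableRep Q k}

theorem toFun_inMap (μ : RepMarking ϖ n ρ M X) {i : Q} (a : ℕ)
    (y : powTorsion ϖ (∀ f : (Σ j : Q, (j ⟶ i)), M.obj f.1) a) :
    (μ.mark i).toFun a (powTorsionMap ϖ (M.inMap i) a y) =
      X.inMap i a fun f => (μ.mark f.1).toFun a (powTorsionMap ϖ (LinearMap.proj f) a y) := by
  simp_rw [X.inMap_apply, μ.map_mark, ← map_sum]
  congr 1
  refine Subtype.ext ?_
  rw [coe_powTorsionMap, M.inMap_apply, AddSubmonoidClass.coe_finsetSum]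
  rfl

theorem exists_iso [RingHomSurjective ρ] (μ : RepMarking ϖ n ρ M X) (ν : RepMarking ϖ n ρ M Y) :
    Nonempty (X.Iso Y) := by
  choose e he using fun i => (μ.mark i).exists_linearEquiv (ν.mark i)
  choose eZ _ using fun i => exists_linearEquiv_of_ker_eq (μ.isCokernelMarking i).surjective
    (ν.isCokernelMarking i).surjective fun x =>
      ((μ.isCokernelMarking i).eq_zero_iff x).trans ((ν.isCokernelMarking i).eq_zero_iff x).symm
  refine ⟨⟨e, eZ, fun i a b => ((μ.mark i).surjective a).forall.2 fun x => ?_,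
    fun {i j} f a => ((μ.mark i).surjective a).forall.2 fun x => ?_⟩⟩
  · rw [he, (μ.mark i).tr_apply, he, (ν.mark i).tr_apply]
  · rw [he, μ.map_mark, he, ν.map_mark]

/-- Transport of a marking along an isomorphism of stable representations. -/
def ofStableIso (μ : RepMarking ϖ n ρ M X) (e : X.Iso Y) : RepMarking ϖ n ρ M Y where
  mark i :=
    { toFun := fun a => (e.equiv i a).toLinearMap.comp ((μ.mark i).toFun a)
      surjective := fun a => (e.equiv i a).surjective.comp ((μ.mark i).surjective a)
      eq_zero_iff := fun a x =>
        (e.equiv i a).map_eq_zero_iff.trans ((μ.mark i).eq_zero_iff a x)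
      tr_apply := fun a b x =>
        (e.tr_equiv i a b _).trans (congrArg (e.equiv i b) ((μ.mark i).tr_apply a b x)) }
  γ i := (e.equivZ i).toLinearMap.comp (μ.γ i)
  isCokernelMarking i :=
    ⟨(e.equivZ i).surjective.comp (μ.isCokernelMarking i).surjective, fun x =>
      (e.equivZ i).map_eq_zero_iff.trans ((μ.isCokernelMarking i).eq_zero_iff x)⟩
  map_mark f a x := (e.map_equiv f a _).trans (congrArg (e.equiv _ a) (μ.map_mark f a x))

/-- Transport of a marking along an isomorphism of representations. -/
def ofIso (μ : RepMarking ϖ n ρ M X) (e : N.Iso M) : RepMarking ϖ n ρ N X where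
  mark i := (μ.mark i).ofEquiv (e.equiv i)
  γ i := (μ.γ i).comp (e.equiv i : N.obj i →ₗ[R] M.obj i)
  isCokernelMarking i := by
    refine ⟨(μ.isCokernelMarking i).surjective.comp (e.equiv i).surjective, fun x => ?_⟩
    rw [LinearMap.comp_apply, (μ.isCokernelMarking i).eq_zero_iff,
      (LinearEquiv.piCongrRight fun f : (Σ j : Q, (j ⟶ i)) => e.equiv f.1).surjective.exists]
    refine exists_congr fun y => ?_
    rw [LinearEquiv.coe_coe, ← map_smul, ← (e.equiv i).injective.eq_iff, e.equiv_inMap]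
    rfl
  map_mark f a x := (μ.map_mark f a _).trans
    (congrArg ((μ.mark _).toFun a) (Subtype.ext (e.comm f x).symm))

/-- The marking of a direct sum. -/
def directSum (μ : RepMarking ϖ n ρ M X) (ν : RepMarking ϖ n ρ N Y) :
    RepMarking ϖ n ρ (M.directSum N) (X.directSum Y) where
  mark i := (μ.mark i).prod (ν.mark i)
  γ i := semilinearProdMap (μ.γ i) (ν.γ i)
  isCokernelMarking i := by
    refine ⟨(μ.isCokernelMarking i).surjective.prodMap (ν.isCokernelMarking i).surjective,
      fun x => Prod.ext_iff.trans ((and_congr ((μ.isCokernelMarking i).eq_zero_iff _)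
        ((ν.isCokernelMarking i).eq_zero_iff _)).trans
          ⟨fun ⟨⟨y, hy⟩, ⟨z, hz⟩⟩ => ?_, fun ⟨z, hz⟩ => ?_⟩)⟩
    · exact ⟨_, (QuiverRep.inMap_directSum y z).trans (Prod.ext hy hz)⟩
    · have hz' := (QuiverRep.inMap_directSum (fun f => (z f).1) fun f => (z f).2).symm.trans hz
      exact ⟨⟨_, congrArg Prod.fst hz'⟩, ⟨_, congrArg Prod.snd hz'⟩⟩
  map_mark f a x := Prod.ext (μ.map_mark f a _) (ν.map_mark f a _)

variable [IsLocalRing R]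

theorem nonempty_iso (μ : RepMarking ϖ n ρ M X) (ν : RepMarking ϖ n ρ N X)
    (hϖ : IsUniformizer ϖ n) [RingHomSurjective ρ] (hQ : Quiver.IsAcyclic Q) (hM : M.IsMono)
    (hN : N.IsMono) : Nonempty (M.Iso N) := by
  classical
  obtain ⟨g, hg⟩ := exists_forall_of_isAcyclic hQ
    (T := fun i => {g : M.obj i ≃ₗ[R] N.obj i // ∀ a x,
      (ν.mark i).toFun a (powTorsionMap ϖ (g : M.obj i →ₗ[R] N.obj i) a x) =
        (μ.mark i).toFun a x})
    (S := fun i g g' => ∀ y : (∀ f : (Σ j : Q, (j ⟶ i)), M.obj f.1),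
      g'.1 (M.inMap i y) = N.inMap i fun f => (g f).1 (y f)) fun i g => by
    obtain ⟨g', hg', hgμ⟩ := (μ.mark i).exists_equiv_lift (ν.mark i) hϖ (μ.isCokernelMarking i)
      (hM i) (ν.isCokernelMarking i) (hN i) (LinearEquiv.piCongrRight fun f => (g f).1)
      fun a y => by
        rw [μ.toFun_inMap]
        refine (ν.toFun_inMap a (powTorsionMap ϖ
          (LinearEquiv.piCongrRight fun f => (g f).1).toLinearMap a y)).trans ?_
        exact congrArg (X.inMap i a) <| funext fun f => (g f).2 a
          (powTorsionMap ϖ (LinearMap.proj (φ := fun f : (Σ j : Q, (j ⟶ i)) => M.obj f.1) f) a y)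
    exact ⟨⟨g', hgμ⟩, hg'⟩
  refine ⟨⟨fun i => (g i).1, fun {i j} f x => ?_⟩⟩
  rw [← M.inMap_single, hg, ← N.inMap_single]
  exact congrArg (N.inMap _) <| funext fun f' =>
    Pi.apply_single (fun f : (Σ i : Q, (i ⟶ j)) => (g f.1).1) (fun f => map_zero _) _ _ f'

end RepMarking

theorem exists_isMono_repMarking [IsLocalRing R] (hϖ : IsUniformizer ϖ n) [RingHomSurjective ρ]
    (hn : n ≤ 3) (hQ : Quiver.IsAcyclic Q) (X : StableRep Q k)
    (hX : ∀ i, (X.obj i).IsStandard n) [∀ i, Module.Finite k (X.Z i)] :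
    ∃ M : QuiverRep Q R, M.IsMono ∧ Nonempty (RepMarking ϖ n ρ M X) := by
  classical
  obtain ⟨t, ht⟩ := exists_forall_of_isAcyclic hQ (T := fun i => MarkedModule ϖ n ρ (X.obj i))
    (S := fun i t t' => ∃ (l : (∀ f : (Σ j : Q, (j ⟶ i)), (t f).carrier) →ₗ[R] t'.carrier)
      (γ : t'.carrier →ₛₗ[ρ] X.Z i), Function.Injective l ∧ IsCokernelMarking ϖ n l γ ∧
      ∀ f a x, X.map f.2 a ((t f).mark.toFun a x) =
        t'.mark.toFun a (powTorsionMap ϖ (l ∘ₗ LinearMap.single R _ f) a x)) fun i t => by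
    obtain ⟨N, hN⟩ := hϖ.exists_markedModule (ρ := ρ) hn (hX i)
    choose h hh using fun f => (t f).mark.exists_lift N.mark hϖ (X.map f.2) (X.map_tr f.2)
    obtain ⟨M, l, γ, hl, hγ, hlh⟩ := N.exists_isCokernelMarking hϖ hN
      (LinearMap.lsum R (fun f => (t f).carrier) R h) (Z := X.Z i)
    refine ⟨M, l, γ, hl, hγ, fun f a x => ?_⟩
    rw [← hh]
    refine Eq.trans ?_ (hlh a (powTorsionMap ϖ
      (LinearMap.single R (fun f => (t f).carrier) f) a x)).symm
    exact congrArg (N.mark.toFun a) (Subtype.ext (LinearMap.lsum_piSingle R _ R h f x).symm)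
  choose l γ hl hγ hlX using ht
  let M : QuiverRep Q R :=
    { obj := fun i => (t i).carrier
      map := fun {i j} f => l j ∘ₗ LinearMap.single R
        (fun f : (Σ i : Q, (i ⟶ j)) => (t f.1).carrier) ⟨i, f⟩ }
  have inMap_eq i : M.inMap i = l i := LinearMap.ext fun y => by
    refine (M.inMap_apply y).trans ((map_sum (l i) _ _).symm.trans (congrArg (l i) ?_))
    exact LinearMap.sum_single_apply _ y
  refine ⟨M, fun i => (inMap_eq i).symm ▸ hl i,
    ⟨⟨fun i => (t i).mark, γ, fun i => (inMap_eq i).symm ▸ hγ i, fun f => hlX _ ⟨_, f⟩⟩⟩⟩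

end StableReps

section SocleLayers

variable {R M : Type*} [CommRing R] [AddCommGroup M] [Module R M]

/-- The submodule `M[ϖ] ∩ ϖ ^ (b - 1) M` of `M[ϖ]`, for `1 ≤ b`. Its length is the number of
cyclic summands `R ⧸ ϖ ^ a` of `M` with `b ≤ a`. -/
def socleLayer (ϖ : R) (M : Type*) [AddCommGroup M] [Module R M] (b : ℕ) :
    Submodule R (powTorsion ϖ M 1) :=
  LinearMap.range (powTorsionTransition ϖ M b 1)

variable {ϖ : R}

theorem socleLayer_one : socleLayer ϖ M 1 = ⊤ :=
  LinearMap.range_eq_top.2 fun x => ⟨x, Subtype.ext <| by simp⟩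

theorem socleLayer_anti {a b : ℕ} (ha : 1 ≤ a) (hab : a ≤ b) :
    socleLayer ϖ M b ≤ socleLayer ϖ M a := by
  rintro _ ⟨x, rfl⟩
  refine ⟨powTorsionTransition ϖ M b a x, Subtype.ext ?_⟩
  rw [coe_powTorsionTransition, coe_powTorsionTransition, coe_powTorsionTransition, smul_smul,
    ← pow_add, show a - 1 + (b - a) = b - 1 by omega]

theorem mem_socleLayer_iff {n : ℕ} (hn : ϖ ^ n = 0) {x : powTorsion ϖ M 1} :
    x ∈ socleLayer ϖ M n ↔ ∃ z : M, ϖ ^ (n - 1) • z = x :=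
  ⟨fun ⟨z, hz⟩ => ⟨z, congrArg Subtype.val hz⟩, fun ⟨z, hz⟩ =>
    ⟨⟨z, by rw [Submodule.mem_torsionBy_iff, hn, zero_smul]⟩, Subtype.ext hz⟩⟩

theorem IsCyclicBasis.length_socleLayer [IsLocalRing R] {n : ℕ} {ι : Type*} [Fintype ι]
    {e : ι → M} {a : ι → ℕ} (he : IsCyclicBasis ϖ e a) (hϖ : IsUniformizer ϖ n)
    (ha : ∀ j, a j ≤ n) {b : ℕ} (hb : 1 ≤ b) :
    Module.length R (socleLayer ϖ M b) = Fintype.card {j // b ≤ a j} := by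
  have : RingHomSurjective (IsLocalRing.residue R) := ⟨IsLocalRing.residue_surjective⟩
  have ker_eq : LinearMap.ker (powTorsionTransition ϖ M b 1 ∘ₗ
      Fintype.linearCombination R (he.torsionBasis b)) = LinearMap.ker
        (coordResidue (IsLocalRing.residue R) (Subtype.val : {j // b ≤ a j} → ι)) := by
    ext r
    rw [LinearMap.mem_ker, LinearMap.mem_ker, LinearMap.comp_apply,
      he.powTorsionTransition_linearCombination,
      (he.isCyclicBasis_torsionBasis hϖ ha 1).eq_zero_iff, hϖ.coordResidue_eq_zero_iff,
      Subtype.forall]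
    refine forall_congr' fun j => ?_
    rw [hϖ.pow_dvd_pow_mul_iff ((min_le_left _ _).trans (ha j)),
      show min (a j) 1 - (b - 1 + (a j - b) - (a j - 1)) = if b ≤ a j then 1 else 0 by
        split_ifs <;> omega]
    split_ifs with hj
    · simp only [hj, forall_const, pow_one]
    · simp only [hj, pow_zero, isUnit_one.dvd, IsEmpty.forall_iff]
  rw [socleLayer, ← LinearMap.range_comp_of_range_eq_top _ (LinearMap.range_eq_top.2
      (he.isCyclicBasis_torsionBasis hϖ ha b).surjective), length_range_eq_of_ker_eq ker_eq,
    LinearMap.range_eq_top.2 (coordResidue_surjective Subtype.val_injective), Module.length_top,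
    Module.length_of_free_of_finite, Module.finrank_fintype_fun_eq_card, Module.length_eq_one,
    mul_one]

end SocleLayers

section CountP

theorem countP_le_eq_add_count (α : List ℕ) (b : ℕ) :
    α.countP (b ≤ ·) = α.countP (b + 1 ≤ ·) + α.count b := by
  induction α with
  | nil => rfl
  | cons a α ih =>
    simp only [List.countP_cons, List.count_cons, ih, decide_eq_true_eq, beq_iff_eq]
    split_ifs <;> omega

theorem eq_of_countP_le_eq {α β : List ℕ} (hα : α.Pairwise (· ≥ ·)) (hβ : β.Pairwise (· ≥ ·))
    (h : ∀ b, α.countP (b ≤ ·) = β.countP (b ≤ ·)) : α = β := by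
  refine List.Perm.eq_of_pairwise' hα hβ (List.perm_iff_count.2 fun b => ?_)
  have key := h b
  rwa [countP_le_eq_add_count, countP_le_eq_add_count β, h, Nat.add_left_cancel_iff] at key

theorem card_le_get (α : List ℕ) (b : ℕ) :
    Fintype.card {j : Fin α.length // b ≤ α.get j} = α.countP (b ≤ ·) := by
  rw [Fintype.card_subtype, Finset.card_filter]
  induction α with
  | nil => rfl
  | cons a α ih =>
    rw [List.countP_cons, ← ih]
    refine (Fin.sum_univ_succ (n := α.length) _).trans ?_
    by_cases h : b ≤ a <;> simp [h, add_comm]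

end CountP

namespace HasPartition

variable {R S M N : Type*} [CommRing R] [IsLocalRing R] [CommRing S] [IsLocalRing S]
  [AddCommGroup M] [Module R M] [AddCommGroup N] [Module S N] {α β : List ℕ} {ϖ : R} {ϖ' : S}
  {n : ℕ}

theorem length_socleLayer (h : HasPartition R M α) (hϖ : IsUniformizer ϖ n) {b : ℕ}
    (hb : 1 ≤ b) : Module.length R (socleLayer ϖ M b) = α.countP (b ≤ ·) := by
  obtain ⟨e, he⟩ := h.exists_isCyclicBasis hϖ
  rw [he.length_socleLayer hϖ (fun j => (h.2.1 _ (α.get_mem j)).2.trans_eq hϖ.loewyLength_eq) hb,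
    card_le_get]

theorem eq_of_length_socleLayer (hα : HasPartition R M α) (hβ : HasPartition S N β)
    (hϖ : IsUniformizer ϖ n) (hϖ' : IsUniformizer ϖ' n)
    (h : ∀ b, 1 ≤ b → b ≤ n →
      Module.length R (socleLayer ϖ M b) = Module.length S (socleLayer ϖ' N b)) : α = β := by
  refine eq_of_countP_le_eq hα.1 hβ.1 fun b => ?_
  have countP_eq {c : ℕ} (hc : 1 ≤ c) (hcn : c ≤ n) : α.countP (c ≤ ·) = β.countP (c ≤ ·) := by
    exact_mod_cast (hα.length_socleLayer hϖ hc).symm.trans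
      ((h c hc hcn).trans (hβ.length_socleLayer hϖ' hc))
  have countP_zero {γ : List ℕ} (hγ : ∀ a ∈ γ, 1 ≤ a ∧ a ≤ n) :
      γ.countP (0 ≤ ·) = γ.countP (1 ≤ ·) := List.countP_congr fun a ha => by simp [(hγ a ha).1]
  have countP_eq_zero {γ : List ℕ} (hγ : ∀ a ∈ γ, 1 ≤ a ∧ a ≤ n) (hb : n < b) :
      γ.countP (b ≤ ·) = 0 := List.countP_eq_zero.2 fun a ha => by
    simpa using (hγ a ha).2.trans_lt hb
  replace hα := hϖ.loewyLength_eq ▸ hα.2.1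
  replace hβ := hϖ'.loewyLength_eq ▸ hβ.2.1
  rcases b.eq_zero_or_pos with rfl | hb
  · rw [countP_zero hα, countP_zero hβ, countP_eq le_rfl hϖ.pos]
  · rcases le_or_gt b n with hbn | hbn
    · exact countP_eq hb hbn
    · rw [countP_eq_zero hα hbn, countP_eq_zero hβ hbn]

end HasPartition

section StableCounting

variable {R : Type*} [CommRing R] {k : Type u'} [Field k] {ϖ : R} {n : ℕ} {ρ : R →+* k}
  {M P : Type*} [AddCommGroup M] [Module R M] [AddCommGroup P] [Module R P]

namespace Marking

variable {X : StableSystem k} (μ : Marking ϖ n ρ M X) (hn : ϖ ^ n = 0)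

include μ hn

theorem ker_toFun_one : LinearMap.ker (μ.toFun 1) = socleLayer ϖ M n :=
  Submodule.ext fun x => (μ.eq_zero_iff 1 x).trans (mem_socleLayer_iff hn).symm

theorem length_socleLayer_eq_add [RingHomSurjective ρ] {b : ℕ} (hb : 1 ≤ b) (hbn : b ≤ n) :
    Module.length R (socleLayer ϖ M b) =
      Module.length R (socleLayer ϖ M n) + Module.length k (LinearMap.range (X.tr b 1)) := by
  have map_eq : (socleLayer ϖ M b).map (μ.toFun 1) = LinearMap.range (X.tr b 1) := by
    rw [socleLayer, ← LinearMap.range_comp, ← LinearMap.range_comp_of_range_eq_top (X.tr b 1)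
      (LinearMap.range_eq_top.2 (μ.surjective b))]
    exact congrArg _ (LinearMap.ext fun x => (μ.tr_apply b 1 x).symm)
  rw [length_eq_length_inf_ker_add_length_map (μ.toFun 1), μ.ker_toFun_one hn,
    inf_eq_right.2 (socleLayer_anti hb hbn), map_eq]

end Marking

namespace IsCokernelMarking

variable {Z : Type*} [AddCommGroup Z] [Module k Z] {i : P →ₗ[R] M} {γ : M →ₛₗ[ρ] Z}
  (hγ : IsCokernelMarking ϖ n i γ) (hi : Function.Injective i) (hn : ϖ ^ n = 0)

include hγ hi hn

theorem length_socleLayer_eq_add [RingHomSurjective ρ] :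
    Module.length R (socleLayer ϖ M n) = Module.length R
      (LinearMap.range (powTorsionMap ϖ i 1) ⊓ socleLayer ϖ M n : Submodule R _) +
        Module.length k Z := by
  obtain ⟨l, hl⟩ := exists_comp_eq_of_ker_le (σ := RingHom.id R) (τ := ρ)
    (powTorsionTransition ϖ M n 1).surjective_rangeRestrict
    (g := γ.comp (Submodule.subtype (powTorsion ϖ M n))) fun x hx => (hγ.eq_zero_iff x).2
      ⟨0, (map_zero i).trans (congrArg (fun y => (y.1 : M)) hx).symm⟩
  have range_l : LinearMap.range l = ⊤ := LinearMap.range_eq_top.2 fun z => by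
    obtain ⟨x, rfl⟩ := hγ.surjective z
    exact ⟨_, hl ⟨x, by rw [Submodule.mem_torsionBy_iff, hn, zero_smul]⟩⟩
  have map_ker_l : (LinearMap.ker l).map (socleLayer ϖ M n).subtype =
      LinearMap.range (powTorsionMap ϖ i 1) ⊓ socleLayer ϖ M n := by
    refine Submodule.ext fun y => ⟨?_, ?_⟩
    · rintro ⟨⟨_, x, rfl⟩, hx, rfl⟩
      obtain ⟨z, hz⟩ := (hγ.eq_zero_iff x).1 ((hl x).symm.trans hx)
      have hz' : ϖ ^ 1 • z = 0 := hi <| by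
        rw [map_smul, hz, map_zero]
        exact (powTorsionTransition ϖ M n 1 x).2
      exact ⟨⟨⟨z, hz'⟩, Subtype.ext hz⟩, _, rfl⟩
    · rintro ⟨⟨z, hz⟩, x, rfl⟩
      exact ⟨⟨_, x, rfl⟩, (hl x).trans ((hγ.eq_zero_iff x).2 ⟨z, congrArg Subtype.val hz⟩), rfl⟩
  refine (length_eq_length_ker_add_length_range l).trans ?_
  rw [range_l, Module.length_top, ← map_ker_l]
  exact congrArg (· + _)
    (Submodule.equivMapOfInjective _ (Submodule.injective_subtype _) _).length_eq

theorem length_socleLayer_add_length_range [RingHomSurjective ρ] {X : StableSystem k}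
    (μ : Marking ϖ n ρ M X) :
    Module.length R (socleLayer ϖ M n) +
        Module.length k (LinearMap.range ((μ.toFun 1).comp (powTorsionMap ϖ i 1))) =
      Module.length R (powTorsion ϖ P 1) + Module.length k Z := by
  have injective : Function.Injective (powTorsionMap ϖ i 1) := fun x y h =>
    Subtype.ext (hi (congrArg Subtype.val h))
  rw [hγ.length_socleLayer_eq_add hi hn, (LinearEquiv.ofInjective _ injective).length_eq,
    length_eq_length_inf_ker_add_length_map (μ.toFun 1) (LinearMap.range _), μ.ker_toFun_one hn,
    LinearMap.range_comp]
  ac_rfl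

end IsCokernelMarking

theorem length_powTorsion_pi {ι : Type*} [Fintype ι] {N : ι → Type*} [∀ j, AddCommGroup (N j)]
    [∀ j, Module R (N j)] (a : ℕ) :
    Module.length R (powTorsion ϖ (∀ j, N j) a) = ∑ j, Module.length R (powTorsion ϖ (N j) a) := by
  rw [← Module.length_pi_of_fintype]
  refine (LinearEquiv.ofBijective
    (LinearMap.pi fun j => powTorsionMap ϖ (LinearMap.proj (φ := N) j) a)
    ⟨fun x y h => Subtype.ext (funext fun j => ?_), fun y => ?_⟩).length_eq
  · exact congrArg Subtype.val (congrFun h j)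
  · exact ⟨⟨fun j => y j, funext fun j => (y j).2⟩, rfl⟩

end StableCounting

namespace RepMarking

variable {Q : Type w} [Quiver.{w'} Q] [Fintype Q] [∀ i j : Q, Fintype (i ⟶ j)]
  {R : Type u} [CommRing R] {S : Type v} [CommRing S] {k : Type u'} [Field k] {ϖ : R} {ϖ' : S}
  {n : ℕ} {ρ : R →+* k} {ρ' : S →+* k} {X : StableRep Q k} {M : QuiverRep Q R} {N : QuiverRep Q S}

theorem length_socleLayer_add_length_range (μ : RepMarking ϖ n ρ M X) [RingHomSurjective ρ]
    (hn : ϖ ^ n = 0) (hM : M.IsMono) (i : Q) :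
    Module.length R (socleLayer ϖ (M.obj i) n) +
        Module.length k (LinearMap.range (X.inMap i 1)) =
      ∑ f : (Σ j : Q, (j ⟶ i)), Module.length R (powTorsion ϖ (M.obj f.1) 1) +
        Module.length k (X.Z i) := by
  have range_eq : LinearMap.range (((μ.mark i).toFun 1).comp (powTorsionMap ϖ (M.inMap i) 1)) =
      LinearMap.range (X.inMap i 1) := by
    refine le_antisymm ?_ ?_
    · rintro _ ⟨y, rfl⟩
      exact ⟨_, (μ.toFun_inMap 1 y).symm⟩
    · rintro _ ⟨v, rfl⟩
      choose x hx using fun f : (Σ j : Q, (j ⟶ i)) => (μ.mark f.1).surjective 1 (v f)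
      refine ⟨⟨fun f => x f, funext fun f => (x f).2⟩, (μ.toFun_inMap 1 _).trans ?_⟩
      exact congrArg (X.inMap i 1) (funext hx)
  rw [← range_eq, (μ.isCokernelMarking i).length_socleLayer_add_length_range (hM i) hn,
    length_powTorsion_pi]

theorem length_socleLayer_eq (μ : RepMarking ϖ n ρ M X) (ν : RepMarking ϖ' n ρ' N X)
    [IsLocalRing R] [IsLocalRing S] [RingHomSurjective ρ] [RingHomSurjective ρ']
    (hϖ : IsUniformizer ϖ n) (hϖ' : IsUniformizer ϖ' n) (hQ : Quiver.IsAcyclic Q) (hM : M.IsMono)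
    (hN : N.IsMono) (i : Q) {b : ℕ} (hb : 1 ≤ b) (hbn : b ≤ n) :
    Module.length R (socleLayer ϖ (M.obj i) b) = Module.length S (socleLayer ϖ' (N.obj i) b) := by
  have := hϖ.isNoetherianRing
  induction i using (wellFounded_nonempty_hom_of_isAcyclic hQ).induction generalizing b with
  | h i ih =>
  have powTorsion_eq (f : Σ j : Q, (j ⟶ i)) : Module.length R (powTorsion ϖ (M.obj f.1) 1) =
      Module.length S (powTorsion ϖ' (N.obj f.1) 1) := by
    have h := ih f.1 ⟨f.2⟩ le_rfl hϖ.pos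
    rwa [socleLayer_one, socleLayer_one, Module.length_top, Module.length_top] at h
  have key := μ.length_socleLayer_add_length_range hϖ.pow_self hM i
  have := Module.Finite.of_surjective _ ((μ.mark i).surjective 1)
  rw [Finset.sum_congr rfl fun f _ => powTorsion_eq f,
    ← ν.length_socleLayer_add_length_range hϖ'.pow_self hN i,
    add_left_inj_of_ne_top Module.length_ne_top] at key
  rw [(μ.mark i).length_socleLayer_eq_add hϖ.pow_self hb hbn, key,
    (ν.mark i).length_socleLayer_eq_add hϖ'.pow_self hb hbn]

end RepMarking

/-- The representations `M` and `N`, over two rings with residue field `k`, determine the same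
stable representation. -/
def StablyAlike {Q : Type w} [Quiver.{w'} Q] [Fintype Q] [∀ i j : Q, Fintype (i ⟶ j)]
    {R : Type u} [CommRing R] {S : Type v} [CommRing S] {k : Type u'} [Field k] (n : ℕ) (ϖ : R)
    (ρ : R →+* k) (ϖ' : S) (ρ' : S →+* k) (M : QuiverRep Q R) (N : QuiverRep Q S) : Prop :=
  ∃ X : StableRep Q k, Nonempty (RepMarking ϖ n ρ M X) ∧ Nonempty (RepMarking ϖ' n ρ' N X)

namespace StablyAlike

variable {Q : Type w} [Quiver.{w'} Q] [Fintype Q] [∀ i j : Q, Fintype (i ⟶ j)]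
  {R : Type u} [CommRing R] {S : Type v} [CommRing S] {k : Type u'} [Field k] {n : ℕ} {ϖ : R}
  {ρ : R →+* k} {ϖ' : S} {ρ' : S →+* k} {M M' : QuiverRep Q R} {N N' : QuiverRep Q S}

theorem symm (h : StablyAlike n ϖ ρ ϖ' ρ' M N) : StablyAlike n ϖ' ρ' ϖ ρ N M :=
  h.imp fun _ => And.symm

theorem directSum (h : StablyAlike n ϖ ρ ϖ' ρ' M N) (h' : StablyAlike n ϖ ρ ϖ' ρ' M' N') :
    StablyAlike n ϖ ρ ϖ' ρ' (M.directSum M') (N.directSum N') := by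
  obtain ⟨X, ⟨μ⟩, ⟨ν⟩⟩ := h
  obtain ⟨X', ⟨μ'⟩, ⟨ν'⟩⟩ := h'
  exact ⟨X.directSum X', ⟨μ.directSum μ'⟩, ⟨ν.directSum ν'⟩⟩

theorem nonempty_iso [IsLocalRing S] [RingHomSurjective ρ] [RingHomSurjective ρ']
    (h : StablyAlike n ϖ ρ ϖ' ρ' M N) (h' : StablyAlike n ϖ ρ ϖ' ρ' M' N')
    (hϖ' : IsUniformizer ϖ' n) (hQ : Quiver.IsAcyclic Q) (hN : N.IsMono) (hN' : N'.IsMono)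
    (e : Nonempty (M.Iso M')) : Nonempty (N.Iso N') := by
  obtain ⟨X, ⟨μ⟩, ⟨ν⟩⟩ := h
  obtain ⟨X', ⟨μ'⟩, ⟨ν'⟩⟩ := h'
  obtain ⟨e⟩ := e
  obtain ⟨eX⟩ := μ.exists_iso (μ'.ofIso e)
  exact (ν.ofStableIso eX).nonempty_iso ν' hϖ' hQ hN hN'

variable [IsLocalRing R] [IsLocalRing S] [RingHomSurjective ρ] [RingHomSurjective ρ']
  (hϖ : IsUniformizer ϖ n) (hϖ' : IsUniformizer ϖ' n) (hQ : Quiver.IsAcyclic Q)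

include hϖ hϖ' hQ

variable (ρ ρ') in
theorem exists_isMono (hn : n ≤ 3) (M : QuiverRep Q R) :
    ∃ N : QuiverRep Q S, N.IsMono ∧ StablyAlike n ϖ ρ ϖ' ρ' M N := by
  obtain ⟨X, hX, ⟨μ⟩⟩ := exists_repMarking (ρ := ρ) hϖ hn M
  have (i : Q) : Module.Finite k (X.Z i) :=
    .of_surjective (μ.γ i) (μ.isCokernelMarking i).surjective
  obtain ⟨N, hN, ν⟩ := exists_isMono_repMarking (ρ := ρ') hϖ' hn hQ X hX
  exact ⟨N, hN, X, ⟨μ⟩, ν⟩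

theorem hasPartition (h : StablyAlike n ϖ ρ ϖ' ρ' M N) (hM : M.IsMono) (hN : N.IsMono) {i : Q}
    {α : List ℕ} (hα : HasPartition R (M.obj i) α) : HasPartition S (N.obj i) α := by
  obtain ⟨X, ⟨μ⟩, ⟨ν⟩⟩ := h
  obtain ⟨β, hβ⟩ := hϖ'.exists_hasPartition (N.obj i)
  rwa [hα.eq_of_length_socleLayer hβ hϖ hϖ' fun b hb hbn =>
    μ.length_socleLayer_eq ν hϖ hϖ' hQ hM hN i hb hbn]

theorem isZero (h : StablyAlike n ϖ ρ ϖ' ρ' M N) (hM : M.IsMono) (hN : N.IsMono)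
    (h0 : M.IsZero) : N.IsZero := fun i =>
  have := h0 i
  (h.hasPartition hϖ hϖ' hQ hM hN (i := i) .of_subsingleton).subsingleton

theorem isIndecomposableMono (h : StablyAlike n ϖ ρ ϖ' ρ' M N) (hn : n ≤ 3)
    (hM : M.IsIndecomposableMono) (hN : N.IsMono) : N.IsIndecomposableMono := by
  refine ⟨hN, fun h0 => hM.2.1 (h.symm.isZero hϖ' hϖ hQ hN hM.1 h0), fun C D hC hD e => ?_⟩
  obtain ⟨A, hA, hCA⟩ := exists_isMono ρ' ρ hϖ' hϖ hQ hn C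
  obtain ⟨B, hB, hDB⟩ := exists_isMono ρ' ρ hϖ' hϖ hQ hn D
  have iso : Nonempty (M.Iso (A.directSum B)) :=
    h.symm.nonempty_iso (hCA.directSum hDB) hϖ hQ hM.1 (hA.directSum hB) e
  exact (hM.2.2 A B hA hB iso).imp (hCA.symm.isZero hϖ hϖ' hQ hA hC)
    (hDB.symm.isZero hϖ hϖ' hQ hB hD)

variable (ρ ρ') in
theorem exists_isIndecomposableMono (hn : n ≤ 3) (hM : M.IsIndecomposableMono) :
    ∃ N : QuiverRep Q S, N.IsIndecomposableMono ∧ StablyAlike n ϖ ρ ϖ' ρ' M N := by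
  obtain ⟨N, hN, h⟩ := exists_isMono ρ ρ' hϖ hϖ' hQ hn M
  exact ⟨N, h.isIndecomposableMono hϖ hϖ' hQ hn hM hN, h⟩

end StablyAlike

theorem exists_quotient_equiv {α β : Type*} {s : Setoid α} {t : Setoid β} {r : α → β → Prop}
    (left : ∀ a, ∃ b, r a b) (right : ∀ b, ∃ a, r a b)
    (h : ∀ {a a' b b'}, r a b → r a' b' → (s a a' ↔ t b b')) :
    ∃ φ : Quotient s ≃ Quotient t, ∀ a b, r a b → φ ⟦a⟧ = ⟦b⟧ := by
  choose f hf using left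
  choose g hg using right
  refine ⟨⟨Quotient.map f fun a a' e => (h (hf a) (hf a')).1 e,
    Quotient.map g fun b b' e => (h (hg b) (hg b')).2 e, ?_, ?_⟩, fun a b hab => ?_⟩
  · rintro ⟨a⟩
    exact Quotient.sound ((h (hg _) (hf a)).2 (t.refl _))
  · rintro ⟨b⟩
    exact Quotient.sound ((h (hf _) (hg b)).1 (s.refl _))
  · exact Quotient.sound ((h (hf a) hab).1 (s.refl a))

namespace QuiverRep.IndecMono

variable {Q : Type w} [Quiver.{w'} Q] [Fintype Q] [∀ i j : Q, Fintype (i ⟶ j)] {R : Type u}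
  [CommRing R]

/-- The isomorphism class of an indecomposable object of the monomorphism category. -/
def mk (M : {M : QuiverRep Q R // M.IsIndecomposableMono}) : IndecMono Q R :=
  Quotient.mk _ M

theorem mk_surjective : Function.Surjective (mk : _ → IndecMono Q R) :=
  Quotient.mk_surjective

variable [IsLocalRing R]

theorem hasPartitionVector_mk_iff {M : {M : QuiverRep Q R // M.IsIndecomposableMono}}
    {α : Q → List ℕ} :
    (mk M).HasPartitionVector α ↔ ∀ i, HasPartition R (M.1.obj i) (α i) := by
  refine ⟨fun ⟨N, hN, h⟩ i => ?_, fun h => ⟨M, rfl, h⟩⟩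
  obtain ⟨e⟩ : Nonempty (N.1.Iso M.1) := Quotient.exact hN
  exact (h i).of_linearEquiv (e.equiv i)

theorem existsUnique_hasPartitionVector {ϖ : R} {n : ℕ} (hϖ : IsUniformizer ϖ n)
    (x : IndecMono Q R) : ∃! α : Q → List ℕ, x.HasPartitionVector α := by
  obtain ⟨M, rfl⟩ := mk_surjective x
  simp only [hasPartitionVector_mk_iff]
  choose α hα using fun i => hϖ.exists_hasPartition (M.1.obj i)
  exact ⟨α, hα, fun β hβ => funext fun i =>
    (hβ i).eq_of_length_socleLayer (hα i) hϖ hϖ fun _ _ _ => rfl⟩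

end QuiverRep.IndecMono

theorem exists_indecMono_equiv {Q : Type w} [Quiver.{w'} Q] [Fintype Q]
    [∀ i j : Q, Fintype (i ⟶ j)] {R : Type u} [CommRing R] [IsLocalRing R] {S : Type v}
    [CommRing S] [IsLocalRing S] {k : Type u'} [Field k] (ρ : R →+* k) (ρ' : S →+* k)
    [RingHomSurjective ρ] [RingHomSurjective ρ'] {n : ℕ} {ϖ : R} {ϖ' : S}
    (hϖ : IsUniformizer ϖ n) (hϖ' : IsUniformizer ϖ' n) (hn : n ≤ 3) (hQ : Quiver.IsAcyclic Q) :
    ∃ φ : QuiverRep.IndecMono Q R ≃ QuiverRep.IndecMono Q S,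
      ∀ x α, x.HasPartitionVector α ↔ (φ x).HasPartitionVector α := by
  have left (M : {M : QuiverRep Q R // M.IsIndecomposableMono}) :
      ∃ N : {N : QuiverRep Q S // N.IsIndecomposableMono},
        StablyAlike n ϖ ρ ϖ' ρ' M.1 N.1 := by
    obtain ⟨N, hN, h⟩ := StablyAlike.exists_isIndecomposableMono ρ ρ' hϖ hϖ' hQ hn M.2
    exact ⟨⟨N, hN⟩, h⟩
  have right (N : {N : QuiverRep Q S // N.IsIndecomposableMono}) :
      ∃ M : {M : QuiverRep Q R // M.IsIndecomposableMono},
        StablyAlike n ϖ ρ ϖ' ρ' M.1 N.1 := by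
    obtain ⟨M, hM, h⟩ := StablyAlike.exists_isIndecomposableMono ρ' ρ hϖ' hϖ hQ hn N.2
    exact ⟨⟨M, hM⟩, h.symm⟩
  obtain ⟨φ, hφ⟩ : ∃ φ : QuiverRep.IndecMono Q R ≃ QuiverRep.IndecMono Q S,
      ∀ (M : {M : QuiverRep Q R // M.IsIndecomposableMono})
        (N : {N : QuiverRep Q S // N.IsIndecomposableMono}),
        StablyAlike n ϖ ρ ϖ' ρ' M.1 N.1 → φ (.mk M) = .mk N :=
    exists_quotient_equiv left right fun {M M' N N'} h h' =>
      ⟨h.nonempty_iso h' hϖ' hQ N.2.1 N'.2.1, h.symm.nonempty_iso h'.symm hϖ hQ M.2.1 M'.2.1⟩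
  refine ⟨φ, fun x α => ?_⟩
  obtain ⟨M, rfl⟩ := QuiverRep.IndecMono.mk_surjective x
  obtain ⟨N, h⟩ := left M
  simp only [hφ M N h, QuiverRep.IndecMono.hasPartitionVector_mk_iff]
  exact forall_congr' fun i => ⟨h.hasPartition hϖ hϖ' hQ M.2.1 N.2.1,
    h.symm.hasPartition hϖ' hϖ hQ N.2.1 M.2.1⟩

theorem mainTheorem4 {Λ : Type u} {Γ : Type v} [CommRing Λ] [CommRing Γ]
    [IsLocalRing Λ] [IsLocalRing Γ]
    (hΛ : IsUniserialRing Λ) (hΓ : IsUniserialRing Γ)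
    (n : ℕ) (hn : n ≤ 3) (hnΛ : loewyLength Λ = n) (hnΓ : loewyLength Γ = n)
    (hk : Nonempty (IsLocalRing.ResidueField Λ ≃+* IsLocalRing.ResidueField Γ))
    (Q : Type w) [Quiver.{w'} Q] [Fintype Q] [∀ i j : Q, Fintype (i ⟶ j)]
    (hQ : Quiver.IsAcyclic Q) :
    ∃ φ : QuiverRep.IndecMono Q Λ ≃ QuiverRep.IndecMono Q Γ,
      ∀ x : QuiverRep.IndecMono Q Λ,
        (∃! α : Q → List ℕ, x.HasPartitionVector α) ∧
          ∀ α : Q → List ℕ, x.HasPartitionVector α ↔ (φ x).HasPartitionVector α := by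
  obtain ⟨ε⟩ := hk
  obtain ⟨ϖ, hϖ⟩ := hΛ.exists_isUniformizer
  obtain ⟨ϖ', hϖ'⟩ := hΓ.exists_isUniformizer
  rw [hnΛ] at hϖ
  rw [hnΓ] at hϖ'
  have : RingHomSurjective (IsLocalRing.residue Λ) := ⟨IsLocalRing.residue_surjective⟩
  let ρ : Γ →+* IsLocalRing.ResidueField Λ := (ε.symm : _ →+* _).comp (IsLocalRing.residue Γ)
  have : RingHomSurjective ρ := ⟨ε.symm.surjective.comp IsLocalRing.residue_surjective⟩
  obtain ⟨φ, hφ⟩ := exists_indecMono_equiv (IsLocalRing.residue Λ) ρ hϖ hϖ' hn hQ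
  exact ⟨φ, fun x => ⟨x.existsUnique_hasPartitionVector hϖ, hφ x⟩⟩
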